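/- Let $\mathcal A=\{A_1,\dots,A_m\}$ be an irreducible family of real $d\times d$ matrices (no common invariant subspace of $\mathbb R^d$ other than $0$ and $\mathbb R^d$). To a nonempty word $d_n\dots d_1$ over $\{1,\dots,m\}$ we associate the product $A_{d_n}\cdots A_{d_1}$ of length $n$, and we identify products with words; a product is simple if its word is not a power of a shorter word. Let $r\ge 1$ and let $\Pi_1,\dots,\Pi_r$ be simple products of lengths $n_1,\dots,n_r$, no two of which are cyclic permutations of each other, such that $[\rho(\Pi_1)]^{1/n_1}=\dots=[\rho(\Pi_r)]^{1/n_r}=\rho_c>0$, where $\rho(\cdot)$ is the spectral radius. Put $\tilde A_s=\rho_c^{-1}A_s$, $\tilde{\mathcal A}=\rho_c^{-1}\mathcal A$, and let $\tilde\Pi_i$ be the corresponding products of normalized matrices, so that $\rho(\tilde\Pi_i)=1$. Assume that $1$ is an eigenvalue of every $\tilde\Pi_i$, and fix real vectors $v_i\neq 0$ with $\tilde\Pi_i v_i=v_i$. If $\tilde\Pi_i=\tilde A_{d_{n}}\cdots\tilde A_{d_1}$, $n=n_i$, the root $\mathcal H_i=\{v_i^{(1)},\dots,v_i^{(n)}\}$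 consists of $v_i^{(1)}=v_i$ and $v_i^{(l)}=\tilde A_{d_{l-1}}\cdots\tilde A_{d_1}v_i$, $2\le l\le n$; these vectors form the cycle $v_i^{(1)}\to v_i^{(2)}\to\dots\to v_i^{(n)}\to v_i^{(1)}$, where the step from $v_i^{(l)}$ is made by $\tilde A_{d_l}$. Let $\alpha=(\alpha_1,\dots,\alpha_r)$ be a vector of positive numbers (a balancing vector). For $M\subset\mathbb R^d$ write $\mathrm{absco}(M)=\mathrm{co}(M\cup -M)$. Algorithm. Start with $\mathcal V_0=\mathcal R_0=\bigcup_i\alpha_i\mathcal H_i$. In iteration $k\ge1$ put first $\mathcal V_k=\mathcal V_{k-1}$, $\mathcal R_k=\emptyset$; then process, one after another and in an arbitrary order, all points $\tilde A_s v$ with $v\in\mathcal R_{k-1}$, $1\le s\le m$, where in the first iteration the steps of the cycles (the matrix $\tilde A_{d_l}$ applied to the root vector $\alpha_i v_i^{(l)}$) are skipped: if $\tilde A_s v$ is an interior point of $\mathrm{absco}(\mathcal V_k)$ for the current $\mathcal V_k$, nothing is changed; otherwise $\tilde A_s v$ is added to both $\mathcal V_k$ and $\mathcal R_k$. The algorithm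 halts when $\mathcal R_k=\emptyset$ at the end of an iteration $k \ge 1$. Theorem. Whatever the order of processing, the algorithm terminates after finitely many iterations if and only if the following three conditions hold: (1) $\Pi_1,\dots,\Pi_r$ are dominant for $\mathcal A$: there is $\gamma<1$ such that $\rho(\tilde\Pi)<\gamma$ for every product $\tilde\Pi$ (of any length at least one) of matrices of $\tilde{\mathcal A}$ that is neither a power of some $\tilde\Pi_i$ nor a power of a cyclic permutation of some $\tilde\Pi_i$; (2) the leading eigenvalue of each $\Pi_i$ is unique and simple: exactly one complex eigenvalue of $\Pi_i$ has modulus $\rho(\Pi_i)$, and its algebraic multiplicity is one; (3) $\alpha$ is admissible: $\alpha_i q_{ij}<\alpha_j$ for all $i\ne j$, where $$q_{ij}=\sup\bigl\{\,|(v_j^*,\tilde\Pi z)|\ :\ z\in\mathcal H_i,\ \tilde\Pi\in\tilde{\mathcal A}^p,\ p\ge0\,\bigr\}$$ and $v_j^*$ is the leading eigenvector of the adjoint matrix, $\tilde\Pi_j^*v_j^*=v_j^*$, normalized by $(v_j^*,v_j)=1$. -/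

import Mathlib

open scoped Matrix

noncomputable section

namespace InvariantPolytope

/-! ### Families of matrices, words and products -/

/-- A family of matrices is irreducible if it has no common invariant subspace other than
`0` and the whole space. -/
def IrreducibleFamily {d m : ℕ} (A : Fin m → Matrix (Fin d) (Fin d) ℝ) : Prop :=
  ∀ U : Submodule ℝ (Fin d → ℝ), (∀ s, ∀ x ∈ U, A s *ᵥ x ∈ U) → U = ⊥ ∨ U = ⊤

/-- The product `A_{d_n} ⋯ A_{d_1}` attached to the word `[d_1, …, d_n]`: letters are listed in
the order in which the matrices act on a vector. -/
def wordProd {d m : ℕ} (A : Fin m → Matrix (Fin d) (Fin d) ℝ) (w : List (Fin m)) :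
    Matrix (Fin d) (Fin d) ℝ :=
  (w.map A).reverse.prod

/-- The word `w` is the power `u ^ k` for some `k ≥ 1`. -/
def IsPowerOf {m : ℕ} (w u : List (Fin m)) : Prop :=
  ∃ k : ℕ, 1 ≤ k ∧ w = (List.replicate k u).flatten

/-- A nonempty word that is not a power of a shorter word. -/
def SimpleWord {m : ℕ} (w : List (Fin m)) : Prop :=
  w ≠ [] ∧ ∀ u : List (Fin m), u.length < w.length → ¬ IsPowerOf w u

/-- The spectral radius of a real matrix: the largest modulus of its complex eigenvalues. -/
def specRad {d : ℕ} (M : Matrix (Fin d) (Fin d) ℝ) : ℝ :=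
  (spectralRadius ℂ (M.map (algebraMap ℝ ℂ))).toReal

/-- The normalized family `c⁻¹ A`. -/
def normalizedFamily {d m : ℕ} (A : Fin m → Matrix (Fin d) (Fin d) ℝ) (c : ℝ) :
    Fin m → Matrix (Fin d) (Fin d) ℝ :=
  fun s => c⁻¹ • A s

/-- Exactly one complex eigenvalue of `M` has modulus equal to the spectral radius of `M`, and its
algebraic multiplicity is one. -/
def UniqueSimpleLeadingEigenvalue {d : ℕ} (M : Matrix (Fin d) (Fin d) ℝ) : Prop :=
  ∃ μ : ℂ, ‖μ‖ = specRad M ∧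
    (M.map (algebraMap ℝ ℂ)).charpoly.rootMultiplicity μ = 1 ∧
    ∀ ν : ℂ, (M.map (algebraMap ℝ ℂ)).charpoly.IsRoot ν → ‖ν‖ = specRad M → ν = μ

/-- Joint dominance of the products with words `W 0, …, W (r - 1)`: the averaged spectral radii
have a common value `c`, and for some `γ < 1` every product of matrices of `c⁻¹ A` whose word is
not a power of a cyclic permutation of one of the `W i` has spectral radius less than `γ`. -/
def Dominant {d m r : ℕ} (A : Fin m → Matrix (Fin d) (Fin d) ℝ) (W : Fin r → List (Fin m)) :
    Prop :=
  ∃ c : ℝ, (∀ i, specRad (wordProd A (W i)) ^ (1 / ((W i).length : ℝ)) = c) ∧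
    ∃ γ : ℝ, γ < 1 ∧ ∀ w : List (Fin m), w ≠ [] →
      (¬ ∃ i, ∃ u, u.IsRotated (W i) ∧ IsPowerOf w u) →
        specRad (wordProd (normalizedFamily A c) w) < γ

/-! ### Roots, the quantities `q i j` and admissible balancing vectors

From here on `A` plays the role of the normalized family. -/

/-- The `l`-th vector `A_{d_l} ⋯ A_{d_1} v` of the root generated by the word `[d_1, …, d_n]` and
the vector `v`, where `l = 0, …, n - 1`. -/
def rootVec {d m : ℕ} (A : Fin m → Matrix (Fin d) (Fin d) ℝ) (w : List (Fin m))
    (v : Fin d → ℝ) (l : Fin w.length) : Fin d → ℝ :=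
  wordProd A (w.take l) *ᵥ v

/-- The supremum of `|(f, z)|` over all images `z` of the vectors of the root generated by `w` and
`v` under products (of any length, including zero) of matrices of the family. It takes values in
`[0, ∞]`. -/
def q {d m : ℕ} (A : Fin m → Matrix (Fin d) (Fin d) ℝ) (w : List (Fin m))
    (v f : Fin d → ℝ) : ENNReal :=
  ⨆ (l : Fin w.length) (u : List (Fin m)),
    ENNReal.ofReal |f ⬝ᵥ (wordProd A u *ᵥ rootVec A w v l)|

/-- Admissibility of the balancing vector `α`: `α i * q i j < α j` for all `i ≠ j`, where `q i j`
is taken with respect to the adjoint leading eigenvector `f j` of the `j`-th product, normalized by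
`(f j, v j) = 1`. -/
def Admissible {d m r : ℕ} (A : Fin m → Matrix (Fin d) (Fin d) ℝ) (W : Fin r → List (Fin m))
    (v : Fin r → Fin d → ℝ) (α : Fin r → ℝ) : Prop :=
  ∃ f : Fin r → Fin d → ℝ,
    (∀ j, (wordProd A (W j))ᵀ *ᵥ f j = f j ∧ f j ⬝ᵥ v j = 1) ∧
    ∀ i j, i ≠ j → ENNReal.ofReal (α i) * q A (W i) (v i) (f j) < ENNReal.ofReal (α j)

/-! ### The algorithm -/

/-- The symmetrized convex hull `co (M ∪ -M)`. -/
def absco {d : ℕ} (M : Set (Fin d → ℝ)) : Set (Fin d → ℝ) :=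
  convexHull ℝ (M ∪ (fun x => -x) '' M)

open Classical in
/-- Processing one point `x` when the current sets are `S = (V, R)`: if `x` is interior to
`absco V` it is absorbed and nothing changes, otherwise it is added to both sets. -/
def testPoint {d : ℕ} (S : Finset (Fin d → ℝ) × Finset (Fin d → ℝ)) (x : Fin d → ℝ) :
    Finset (Fin d → ℝ) × Finset (Fin d → ℝ) :=
  if x ∈ interior (absco (S.1 : Set (Fin d → ℝ))) then S else (insert x S.1, insert x S.2)

/-- One iteration: starting from the set `V` and the empty set `R`, the points of the list are
processed one after another. -/
def iteration {d : ℕ} (V : Finset (Fin d → ℝ)) (L : List (Fin d → ℝ)) :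
    Finset (Fin d → ℝ) × Finset (Fin d → ℝ) :=
  L.foldl testPoint (V, ∅)

open Classical in
/-- The initial set: all vectors of the roots, the `i`-th root being multiplied by `α i`. -/
def initialSet {d m r : ℕ} (A : Fin m → Matrix (Fin d) (Fin d) ℝ) (W : Fin r → List (Fin m))
    (v : Fin r → Fin d → ℝ) (α : Fin r → ℝ) : Finset (Fin d → ℝ) :=
  Finset.univ.image fun p : (i : Fin r) × Fin (W i).length =>
    α p.1 • rootVec A (W p.1) (v p.1) p.2

open Classical in
/-- The points to be tested in the first iteration: the images of the root vectors under all
matrices of the family, except that for the `l`-th vector of a root the matrix that carries it to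
the next vector of the same root is skipped. -/
def rootChildren {d m r : ℕ} (A : Fin m → Matrix (Fin d) (Fin d) ℝ) (W : Fin r → List (Fin m))
    (v : Fin r → Fin d → ℝ) (α : Fin r → ℝ) : Finset (Fin d → ℝ) :=
  (Finset.univ.filter fun p : ((i : Fin r) × Fin (W i).length) × Fin m =>
      p.2 ≠ (W p.1.1).get p.1.2).image fun p =>
    A p.2 *ᵥ (α p.1.1 • rootVec A (W p.1.1) (v p.1.1) p.1.2)

open Classical in
/-- The points to be tested in every later iteration: all images of the points added in the
previous iteration under all matrices of the family. -/
def children {d m : ℕ} (A : Fin m → Matrix (Fin d) (Fin d) ℝ) (R : Finset (Fin d → ℝ)) :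
    Finset (Fin d → ℝ) :=
  (R ×ˢ (Finset.univ : Finset (Fin m))).image fun p => A p.2 *ᵥ p.1

/-- The pair `(V_k, R_k)` after `k` iterations. In iteration `k + 1` the points are processed in
the order prescribed by `order k`. -/
def state {d m r : ℕ} (A : Fin m → Matrix (Fin d) (Fin d) ℝ) (W : Fin r → List (Fin m))
    (v : Fin r → Fin d → ℝ) (α : Fin r → ℝ)
    (order : ℕ → Finset (Fin d → ℝ) → List (Fin d → ℝ)) :
    ℕ → Finset (Fin d → ℝ) × Finset (Fin d → ℝ)
  | 0 => (initialSet A W v α, initialSet A W v α)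
  | 1 => iteration (initialSet A W v α) (order 0 (rootChildren A W v α))
  | k + 2 =>
      iteration (state A W v α order (k + 1)).1
        (order (k + 1) (children A (state A W v α order (k + 1)).2))

/-- The algorithm halts: in some iteration no point is added. -/
def Terminates {d m r : ℕ} (A : Fin m → Matrix (Fin d) (Fin d) ℝ) (W : Fin r → List (Fin m))
    (v : Fin r → Fin d → ℝ) (α : Fin r → ℝ)
    (order : ℕ → Finset (Fin d → ℝ) → List (Fin d → ℝ)) : Prop :=
  ∃ k : ℕ, 1 ≤ k ∧ (state A W v α order k).2 = ∅

end InvariantPolytope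

end

open InvariantPolytope

/-!
# Termination of the invariant polytope algorithm with balancing

Throughout, the family is normalized, so that the leading products have spectral radius one. The
bridge between the algorithm and the spectral conditions is that, for a matrix `M` with `M v = v`,
`Mᵀ f = f`, `(f, v) = 1` and spectral radius one, the leading eigenvalue is unique and simple if and
only if `M ^ k x → (f, x) v` for all `x` (`exists_pow_mulVec_sub_le`,
`uniqueSimpleLeadingEigenvalue_of_tendsto`).

*Termination implies the conditions.* The final set spans an invariant polytope `P`, and a word that
leaves the cycle of a root sends the vertex into the interior, hence into `l P` for a uniform
`l < 1`, after a bounded number of further letters (`exists_isContractingPolytope`). By periodicity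
a power of a word that is no power of a cyclic permutation of some `W i` leaves every cycle
(`SimpleWord.isPowerOf_of_agree`), so a fixed power of its product maps `P` into `l P`: this is
dominance. For `W j` itself the only vertex that is not contracted is the fixed vector `α j • v j`.
Therefore the powers of the product converge to a rank one projection, and the adjoint eigenvector
is at most `α j` on `P`, and at most `l α j` on the orbits of the other roots: this is admissibility.

*The conditions imply termination.* Dominance bounds the traces of all products. Because the trace
form of the algebra generated by an irreducible family is nondegenerate, the semigroup of products
is bounded (`exists_bound_of_trace_bound`). In a bounded set of matrices a matrix with an
approximate eigenvalue of modulus near one has spectral radius near one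
(`exists_approx_eigen_bound`), so by dominance a product that almost fixes a vector follows a cycle.
This has two consequences. An orbit that leaves the cycle of the `i`-th root at once has a component
along each `v j` that is smaller than `α j` by a uniform factor (`exists_uniform_gap`), so that it is
absorbed as soon as it turns around the `j`-th cycle often enough
(`exists_pow_mulVec_mem_interior`). A long path that is never absorbed stays in a compact set away
from zero, so it comes back close to itself along a long word; this word turns around a cycle many
times, a contradiction (`terminates_of_dominant`).
-/

open scoped Matrix
open InvariantPolytope
namespace InvariantPolytope

/-! ### Periodic words -/

/-- The `t`-th letter of the periodic sequence `w w w ⋯`. It is an optional letter, so that no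
nonemptiness proof has to be carried along; it is `none` only for the empty word. -/
def cyc {m : ℕ} (w : List (Fin m)) (t : ℕ) : Option (Fin m) := w[t % w.length]?

section Words

variable {m : ℕ} {w W : List (Fin m)}

lemma cyc_add_mul_length (w : List (Fin m)) (t k : ℕ) :
    cyc w (t + k * w.length) = cyc w t := by
  simp [cyc]

lemma cyc_of_lt {t : ℕ} (h : t < w.length) : cyc w t = w[t]? := by
  simp [cyc, Nat.mod_eq_of_lt h]

lemma cyc_eq_of_modEq {s t : ℕ} (h : s ≡ t [MOD w.length]) : cyc w s = cyc w t := by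
  unfold cyc; rw [h]

lemma getElem?_flatten_replicate (w : List (Fin m)) (k : ℕ) {q : ℕ} (hq : q < k * w.length) :
    (List.replicate k w).flatten[q]? = cyc w q := by
  induction k generalizing q with
  | zero => simp at hq
  | succ k ih =>
    rw [List.replicate_succ, List.flatten_cons]
    by_cases h : q < w.length
    · rw [List.getElem?_append_left h, cyc_of_lt h]
    · rw [List.getElem?_append_right (by omega), ih (by rw [Nat.succ_mul] at hq; omega)]
      have := cyc_add_mul_length w (q - w.length) 1
      rw [← this]; congr 1; omega

lemma cyc_rotate (w : List (Fin m)) (o t : ℕ) : cyc (w.rotate o) t = cyc w (t + o) := by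
  unfold cyc
  rcases Nat.eq_zero_or_pos w.length with h | h
  · simp [List.length_eq_zero_iff.1 h]
  · rw [List.length_rotate, List.getElem?_rotate (Nat.mod_lt _ h)]
    simp

lemma SimpleWord.length_pos (hW : SimpleWord W) : 0 < W.length :=
  List.length_pos_iff.2 hW.1

/-- The length of a simple word is the least period of the sequence it generates. -/
lemma SimpleWord.length_dvd_of_periodic (hW : SimpleWord W) {p : ℕ}
    (hp : ∀ t, cyc W (t + p) = cyc W t) : W.length ∣ p := by
  have hn := hW.length_pos
  by_cases hg : Nat.gcd p W.length < W.length
  · exfalso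
    obtain ⟨a, -, ha⟩ := Nat.exists_mul_mod_eq_gcd hg
    set g := Nat.gcd p W.length with hgdef
    have hpa : ∀ a t, cyc W (t + p * a) = cyc W t := by
      intro a
      induction a with
      | zero => simp
      | succ a ih => intro t; rw [Nat.mul_succ, ← add_assoc, hp, ih]
    have hper : ∀ t, cyc W (t + g) = cyc W t := by
      intro t
      rw [← hpa a t]
      apply cyc_eq_of_modEq
      rw [← ha]
      exact Nat.ModEq.add_left _ (Nat.mod_modEq _ _)
    have hperk : ∀ k t, cyc W (t + g * k) = cyc W t := by
      intro k
      induction k with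
      | zero => simp
      | succ k ih => intro t; rw [Nat.mul_succ, ← add_assoc, hper, ih]
    have hg0 : 0 < g := Nat.gcd_pos_of_pos_right _ hn
    obtain ⟨k, hk⟩ : g ∣ W.length := Nat.gcd_dvd_right _ _
    have hlen : (W.take g).length = g := by simp [hg.le]
    refine hW.2 (W.take g) (by omega) ⟨k, ?_, ?_⟩
    · by_contra hk0
      rw [Nat.lt_one_iff.1 (not_le.1 hk0)] at hk
      omega
    · apply List.ext_getElem?
      intro q
      by_cases hq : q < W.length
      · rw [getElem?_flatten_replicate _ _ (by rw [hlen, mul_comm]; omega)]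
        have hq' : q % g < g := Nat.mod_lt _ hg0
        rw [cyc, hlen, List.getElem?_take_of_lt hq', ← cyc_of_lt hq,
          ← cyc_of_lt (lt_trans hq' hg), ← hperk (q / g) (q % g), Nat.mod_add_div]
      · rw [List.getElem?_eq_none (by omega), List.getElem?_eq_none]
        simp only [List.length_flatten, List.map_replicate, List.sum_replicate, hlen, smul_eq_mul]
        rw [mul_comm]; omega
  · have : Nat.gcd p W.length = W.length :=
      le_antisymm (Nat.le_of_dvd hn (Nat.gcd_dvd_right _ _)) (not_lt.1 hg)
    rw [← this]; exact Nat.gcd_dvd_left _ _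

/-- If the periodic sequences of `w` and of a simple word `W`, the latter read from position `o`,
agree on a common period, then they agree everywhere and the length of `w` is a multiple of that
of `W`. -/
lemma SimpleWord.cyc_eq_of_agree (hW : SimpleWord W) (hw : w ≠ []) {o : ℕ}
    (h : ∀ q < W.length * w.length, cyc w q = cyc W (o + q)) :
    W.length ∣ w.length ∧ ∀ q, cyc w q = cyc W (o + q) := by
  have hn := hW.length_pos
  have hp : 0 < w.length := List.length_pos_iff.2 hw
  have hall : ∀ q, cyc w q = cyc W (o + q) := by
    intro q
    have h1 := h (q % (W.length * w.length)) (Nat.mod_lt _ (Nat.mul_pos hn hp))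
    have hm : q % (W.length * w.length) ≡ q [MOD (W.length * w.length)] := Nat.mod_modEq _ _
    rw [cyc_eq_of_modEq (hm.of_dvd (Dvd.intro_left _ rfl))] at h1
    rw [h1]
    exact cyc_eq_of_modEq ((hm.of_dvd (Dvd.intro _ rfl)).add_left _)
  refine ⟨hW.length_dvd_of_periodic fun t => ?_, hall⟩
  -- `t` is congruent to a position behind `o`
  have h2 := hall (t + o * (W.length - 1))
  have h3 := hall (t + o * (W.length - 1) + w.length)
  have h4 := cyc_add_mul_length w (t + o * (W.length - 1)) 1
  rw [one_mul] at h4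
  have e : o + (t + o * (W.length - 1)) = t + o * W.length := by
    obtain ⟨n, hn'⟩ : ∃ n, W.length = n + 1 := ⟨W.length - 1, by omega⟩
    rw [hn']; simp; ring
  have e' : o + (t + o * (W.length - 1) + w.length) = t + w.length + o * W.length := by omega
  rw [h4, h2, e, e', cyc_add_mul_length, cyc_add_mul_length] at h3
  exact h3.symm

lemma eq_flatten_replicate_rotate {k o : ℕ} (hl : w.length = k * W.length)
    (h : ∀ q < w.length, w[q]? = cyc W (o + q)) :
    w = (List.replicate k (W.rotate o)).flatten := by
  apply List.ext_getElem?
  intro q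
  by_cases hq : q < w.length
  · rw [getElem?_flatten_replicate _ _ (by rw [List.length_rotate]; omega), cyc_rotate, h q hq,
      add_comm]
  · rw [List.getElem?_eq_none (by omega), List.getElem?_eq_none]
    simp only [List.length_flatten, List.map_replicate, List.sum_replicate, List.length_rotate,
      smul_eq_mul]
    omega

lemma SimpleWord.isPowerOf_of_agree (hW : SimpleWord W) (hw : w ≠ []) {o : ℕ}
    (h : ∀ q < W.length * w.length, cyc w q = cyc W (o + q)) :
    IsPowerOf w (W.rotate o) := by
  obtain ⟨⟨k, hk⟩, hall⟩ := hW.cyc_eq_of_agree hw h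
  rw [mul_comm] at hk
  refine ⟨k, ?_, eq_flatten_replicate_rotate hk fun q hq => by rw [← cyc_of_lt hq, hall]⟩
  rcases k with _ | k
  · simp at hk; exact absurd hk hw
  · omega

/-- Two simple words whose periodic sequences agree up to a shift are cyclic permutations of each
other. -/
lemma SimpleWord.eq_rotate_of_agree {W' : List (Fin m)} (hW : SimpleWord W)
    (hW' : SimpleWord W') {o : ℕ}
    (h : ∀ q < W.length * W'.length, cyc W' q = cyc W (o + q)) : W' = W.rotate o := by
  obtain ⟨⟨k, hk⟩, hall⟩ := hW.cyc_eq_of_agree hW'.1 h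
  have hlt : ¬ (W.rotate o).length < W'.length := fun hlt =>
    hW'.2 _ hlt (hW.isPowerOf_of_agree hW'.1 h)
  have hk1 : k = 1 := by
    have h1 := hW'.length_pos
    have h2 := hW.length_pos
    rw [List.length_rotate, hk] at hlt
    rw [hk] at h1
    have h3 : 0 < k := Nat.pos_of_ne_zero fun h0 => by simp [h0] at h1
    by_contra hne
    have : 2 ≤ k := by omega
    nlinarith
  have := eq_flatten_replicate_rotate (w := W') (W := W) (k := k) (o := o) (by rw [hk, mul_comm])
    fun q hq => by rw [← cyc_of_lt hq, hall]
  simpa [hk1] using this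

lemma SimpleWord.length_dvd_of_rotate_eq (hW : SimpleWord W) {o : ℕ} (h : W.rotate o = W) :
    W.length ∣ o :=
  hW.length_dvd_of_periodic fun t => by rw [← cyc_rotate, h]

/-- A power of a cyclic permutation of `W` is a piece of the periodic sequence of `W`. -/
lemma exists_agree_of_isPowerOf_rotated {u : List (Fin m)} (hu : u.IsRotated W)
    (hw : IsPowerOf w u) :
    W.length ∣ w.length ∧ ∃ o, ∀ q < w.length, w[q]? = cyc W (o + q) := by
  obtain ⟨k, -, rfl⟩ := hw
  obtain ⟨o, rfl⟩ := hu.symm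
  have hlen : (List.replicate k (W.rotate o)).flatten.length = k * W.length := by simp
  refine ⟨by rw [hlen]; exact Dvd.intro_left _ rfl, o, fun q hq => ?_⟩
  rw [hlen] at hq
  rw [getElem?_flatten_replicate _ _ (by simpa using hq), cyc_rotate, add_comm]

end Words

/-! ### Spectral radius and leading eigenvalue -/

section Spectral

open Filter Topology

variable {d : ℕ}

/-- The complexification of a real matrix. -/
noncomputable abbrev complexify (M : Matrix (Fin d) (Fin d) ℝ) : Matrix (Fin d) (Fin d) ℂ :=
  M.map (algebraMap ℝ ℂ)

lemma complexify_pow (M : Matrix (Fin d) (Fin d) ℝ) (k : ℕ) :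
    complexify (M ^ k) = complexify M ^ k :=
  map_pow (algebraMap ℝ ℂ).mapMatrix M k

lemma re_complexify_mulVec (M : Matrix (Fin d) (Fin d) ℝ) (z : Fin d → ℂ) (i : Fin d) :
    ((complexify M *ᵥ z) i).re = (M *ᵥ fun j => (z j).re) i := by
  simp [Matrix.mulVec, dotProduct, Complex.re_sum]

lemma im_complexify_mulVec (M : Matrix (Fin d) (Fin d) ℝ) (z : Fin d → ℂ) (i : Fin d) :
    ((complexify M *ᵥ z) i).im = (M *ᵥ fun j => (z j).im) i := by
  simp [Matrix.mulVec, dotProduct, Complex.im_sum]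

lemma norm_complexify_mulVec_le (M : Matrix (Fin d) (Fin d) ℝ) (z : Fin d → ℂ) :
    ‖complexify M *ᵥ z‖ ≤ ‖M *ᵥ fun j => (z j).re‖ + ‖M *ᵥ fun j => (z j).im‖ := by
  refine (pi_norm_le_iff_of_nonneg (by positivity)).2 fun i => ?_
  refine (Complex.norm_le_abs_re_add_abs_im _).trans ?_
  rw [re_complexify_mulVec, im_complexify_mulVec]
  exact add_le_add (norm_le_pi_norm (M *ᵥ fun j => (z j).re) i)
    (norm_le_pi_norm (M *ᵥ fun j => (z j).im) i)

lemma isRoot_charpoly_iff {K : Type*} [Field K] (M : Matrix (Fin d) (Fin d) K) (μ : K) :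
    M.charpoly.IsRoot μ ↔ ∃ z, z ≠ 0 ∧ M *ᵥ z = μ • z := by
  rw [Polynomial.IsRoot, Matrix.eval_charpoly, ← Matrix.exists_mulVec_eq_zero_iff]
  refine exists_congr fun z => and_congr_right fun _ => ?_
  rw [Matrix.sub_mulVec, sub_eq_zero, Matrix.scalar_apply, ← Matrix.smul_one_eq_diagonal,
    Matrix.smul_mulVec, Matrix.one_mulVec, eq_comm]

lemma pow_mulVec_of_eigen {K : Type*} [Field K] {M : Matrix (Fin d) (Fin d) K} {μ : K}
    {z : Fin d → K} (h : M *ᵥ z = μ • z) (k : ℕ) : (M ^ k) *ᵥ z = μ ^ k • z := by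
  induction k with
  | zero => simp
  | succ k ih => rw [pow_succ, ← Matrix.mulVec_mulVec, h, Matrix.mulVec_smul, ih, smul_smul,
      pow_succ, mul_comm]

attribute [local instance] Matrix.linftyOpNormedRing Matrix.linftyOpNormedAlgebra

lemma exists_isRoot_norm_eq_specRad [NeZero d] (M : Matrix (Fin d) (Fin d) ℝ) :
    ∃ μ : ℂ, (complexify M).charpoly.IsRoot μ ∧ ‖μ‖ = specRad M := by
  have : CompleteSpace (Matrix (Fin d) (Fin d) ℂ) := FiniteDimensional.complete ℂ _
  obtain ⟨μ, hμ, h⟩ := spectrum.exists_nnnorm_eq_spectralRadius (complexify M)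
  refine ⟨μ, Matrix.mem_spectrum_iff_isRoot_charpoly.1 hμ, ?_⟩
  unfold specRad
  rw [← h]; simp

lemma norm_le_specRad [NeZero d] {M : Matrix (Fin d) (Fin d) ℝ} {μ : ℂ}
    (hμ : (complexify M).charpoly.IsRoot μ) : ‖μ‖ ≤ specRad M := by
  have : CompleteSpace (Matrix (Fin d) (Fin d) ℂ) := FiniteDimensional.complete ℂ _
  obtain ⟨ν, -, h⟩ := spectrum.exists_nnnorm_eq_spectralRadius (complexify M)
  have h1 : (‖μ‖₊ : ENNReal) ≤ spectralRadius ℂ (complexify M) :=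
    le_iSup₂ (f := fun (k : ℂ) (_ : k ∈ spectrum ℂ (complexify M)) => (‖k‖₊ : ENNReal)) μ
      (Matrix.mem_spectrum_iff_isRoot_charpoly.2 hμ)
  have h2 : spectralRadius ℂ (complexify M) ≠ ⊤ := by rw [← h]; simp
  have := ENNReal.toReal_mono h2 h1
  exact this

lemma specRad_nonneg (M : Matrix (Fin d) (Fin d) ℝ) : 0 ≤ specRad M := ENNReal.toReal_nonneg

lemma isRoot_complexify_smul {M : Matrix (Fin d) (Fin d) ℝ} {μ : ℂ} (c : ℝ)
    (hμ : (complexify M).charpoly.IsRoot μ) :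
    (complexify (c • M)).charpoly.IsRoot (c * μ) := by
  rw [isRoot_charpoly_iff] at hμ ⊢
  obtain ⟨z, hz, h⟩ := hμ
  refine ⟨z, hz, ?_⟩
  have : complexify (c • M) = (c : ℂ) • complexify M := by
    ext i j; simp
  rw [this, Matrix.smul_mulVec, h, smul_smul]

lemma specRad_smul [NeZero d] (M : Matrix (Fin d) (Fin d) ℝ) {c : ℝ} (hc : 0 < c) :
    specRad (c • M) = c * specRad M := by
  have key : ∀ (M : Matrix (Fin d) (Fin d) ℝ) {c : ℝ}, 0 < c →
      c * specRad M ≤ specRad (c • M) := by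
    intro M c hc
    obtain ⟨μ, hμ, h⟩ := exists_isRoot_norm_eq_specRad M
    have := norm_le_specRad (isRoot_complexify_smul c hμ)
    rwa [norm_mul, Complex.norm_real, Real.norm_of_nonneg hc.le, h] at this
  refine le_antisymm ?_ (key M hc)
  have := key (c • M) (inv_pos.2 hc)
  rw [smul_smul, inv_mul_cancel₀ hc.ne', one_smul] at this
  rwa [inv_mul_le_iff₀ hc] at this

lemma rootMultiplicity_charpoly_eq {K : Type*} [Field K] (M : Matrix (Fin d) (Fin d) K) (μ : K) :
    M.charpoly.rootMultiplicity μ =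
      Module.finrank K (Module.End.maxGenEigenspace (Matrix.toLin' M) μ) := by
  rw [LinearMap.finrank_maxGenEigenspace_eq, Matrix.charpoly_toLin']

lemma UniqueSimpleLeadingEigenvalue.smul [NeZero d] {M : Matrix (Fin d) (Fin d) ℝ}
    (h : UniqueSimpleLeadingEigenvalue M) {c : ℝ} (hc : 0 < c) :
    UniqueSimpleLeadingEigenvalue (c • M) := by
  obtain ⟨μ, h1, h2, h3⟩ := h
  have hc' : (c : ℂ) ≠ 0 := by exact_mod_cast hc.ne'
  have hcM : complexify (c • M) = (c : ℂ) • complexify M := by ext i j; simp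
  refine ⟨c * μ, ?_, ?_, fun ν hν hn => ?_⟩
  · rw [specRad_smul M hc, norm_mul, Complex.norm_real, Real.norm_of_nonneg hc.le, h1]
  · have hspace : Module.End.maxGenEigenspace (Matrix.toLin' (complexify (c • M))) (c * μ) =
        Module.End.maxGenEigenspace (Matrix.toLin' (complexify M)) μ := by
      ext z
      rw [Module.End.mem_maxGenEigenspace, Module.End.mem_maxGenEigenspace]
      refine exists_congr fun k => ?_
      have : Matrix.toLin' (complexify (c • M)) - ((c : ℂ) * μ) • 1 =
          (c : ℂ) • (Matrix.toLin' (complexify M) - μ • 1) := by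
        rw [hcM, map_smul, smul_sub, smul_smul]
      rw [this, smul_pow, LinearMap.smul_apply, smul_eq_zero]
      exact or_iff_right (pow_ne_zero _ hc')
    rw [← h2, rootMultiplicity_charpoly_eq, rootMultiplicity_charpoly_eq, hspace]
  · have h4 := isRoot_complexify_smul c⁻¹ hν
    rw [smul_smul, inv_mul_cancel₀ hc.ne', one_smul] at h4
    have h5 := h3 _ h4 (by
      rw [norm_mul, Complex.norm_real, hn, specRad_smul M hc, Real.norm_of_nonneg (by positivity)]
      field_simp)
    rw [← h5]; push_cast; field_simp

lemma uniqueSimpleLeadingEigenvalue_smul_iff [NeZero d] {M : Matrix (Fin d) (Fin d) ℝ} {c : ℝ}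
    (hc : 0 < c) : UniqueSimpleLeadingEigenvalue (c • M) ↔ UniqueSimpleLeadingEigenvalue M := by
  refine ⟨fun h => ?_, fun h => h.smul hc⟩
  have := h.smul (inv_pos.2 hc)
  rwa [smul_smul, inv_mul_cancel₀ hc.ne', one_smul] at this

/-- Geometric decay of the powers of `M ^ N` with ratio `l` bounds the spectral radius. -/
lemma specRad_pow_le [NeZero d] {M : Matrix (Fin d) (Fin d) ℝ} {N : ℕ} {l : ℝ} (hl : 0 < l)
    (h : ∀ x, ∃ C, ∀ k : ℕ, ‖(M ^ (N * k)) *ᵥ x‖ ≤ C * l ^ k) : specRad M ^ N ≤ l := by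
  obtain ⟨μ, hμ, hn⟩ := exists_isRoot_norm_eq_specRad M
  obtain ⟨z, hz, hez⟩ := (isRoot_charpoly_iff _ _).1 hμ
  obtain ⟨C₁, h₁⟩ := h fun j => (z j).re
  obtain ⟨C₂, h₂⟩ := h fun j => (z j).im
  have hz' : 0 < ‖z‖ := norm_pos_iff.2 hz
  rw [← hn]
  by_contra! hlt
  have hr : 1 < ‖μ‖ ^ N / l := (one_lt_div hl).2 hlt
  obtain ⟨k, hk⟩ := ((tendsto_pow_atTop_atTop_of_one_lt hr).eventually_gt_atTop
    ((C₁ + C₂) / ‖z‖)).exists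
  have h3 : ‖μ‖ ^ (N * k) * ‖z‖ ≤ (C₁ + C₂) * l ^ k := by
    calc ‖μ‖ ^ (N * k) * ‖z‖ = ‖complexify (M ^ (N * k)) *ᵥ z‖ := by
          rw [complexify_pow, pow_mulVec_of_eigen hez, norm_smul, norm_pow]
      _ ≤ _ := norm_complexify_mulVec_le _ _
      _ ≤ _ := by rw [add_mul]; exact add_le_add (h₁ k) (h₂ k)
  rw [div_pow, ← pow_mul, div_lt_div_iff₀ hz' (by positivity)] at hk
  linarith

/-- Gelfand's formula: if the spectral radius is less than one, the powers tend to zero. -/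
lemma exists_pow_mulVec_le [NeZero d] {M : Matrix (Fin d) (Fin d) ℝ} (h : specRad M < 1) {ε : ℝ}
    (hε : 0 < ε) : ∃ N : ℕ, ∀ k ≥ N, ∀ x, ‖(M ^ k) *ᵥ x‖ ≤ ε * ‖x‖ := by
  have : CompleteSpace (Matrix (Fin d) (Fin d) ℂ) := FiniteDimensional.complete ℂ _
  have hlim := spectrum.pow_nnnorm_pow_one_div_tendsto_nhds_spectralRadius (complexify M)
  have h2 : spectralRadius ℂ (complexify M) ≠ ⊤ := by
    obtain ⟨ν, -, h⟩ := spectrum.exists_nnnorm_eq_spectralRadius (complexify M)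
    rw [← h]; simp
  obtain ⟨r, hr0, hr1⟩ := exists_between h
  have hr0' : 0 < r := (specRad_nonneg M).trans_lt hr0
  have hlt : spectralRadius ℂ (complexify M) < ENNReal.ofReal r :=
    (ENNReal.lt_ofReal_iff_toReal_lt h2).2 hr0
  have hz := (tendsto_pow_atTop_nhds_zero_of_lt_one hr0'.le hr1).eventually_lt_const hε
  have hev := (hlim.eventually_lt_const hlt).and (hz.and (eventually_gt_atTop 0))
  obtain ⟨N, hN⟩ := eventually_atTop.1 hev
  refine ⟨N, fun k hk x => ?_⟩
  obtain ⟨h3, h4, h5⟩ := hN k hk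
  have h6 : ‖complexify M ^ k‖ ≤ ε := by
    have h7 := ENNReal.rpow_lt_rpow h3 (z := (k : ℝ)) (by exact_mod_cast h5)
    rw [← ENNReal.rpow_mul, one_div, inv_mul_cancel₀ (by exact_mod_cast h5.ne'),
      ENNReal.rpow_one, ENNReal.rpow_natCast, ← ENNReal.ofReal_pow hr0'.le] at h7
    have h8 := ENNReal.toReal_mono (by simp) h7.le
    rw [ENNReal.toReal_ofReal (by positivity)] at h8
    simp only [ENNReal.coe_toReal, coe_nnnorm] at h8
    linarith
  refine (pi_norm_le_iff_of_nonneg (by positivity)).2 fun i => ?_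
  have h9 := re_complexify_mulVec (M ^ k) (fun j => (x j : ℂ)) i
  simp only [Complex.ofReal_re] at h9
  rw [← h9, complexify_pow, Real.norm_eq_abs]
  refine (Complex.abs_re_le_norm _).trans ((norm_le_pi_norm _ i).trans ?_)
  refine (Matrix.linfty_opNorm_mulVec _ _).trans ?_
  have : ‖fun j => (x j : ℂ)‖ = ‖x‖ := by simp [Pi.norm_def]
  rw [this]
  exact mul_le_mul_of_nonneg_right h6 (norm_nonneg _)

/-- The determinant of `c - M` is the product of the distances from `c` to the complex eigenvalues
of `M`. -/
lemma pow_sub_le_abs_det [NeZero d] {M : Matrix (Fin d) (Fin d) ℝ} {g c : ℝ} (h : specRad M ≤ g)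
    (hc : g ≤ |c|) : (|c| - g) ^ d ≤ |(c • (1 : Matrix (Fin d) (Fin d) ℝ) - M).det| := by
  have h1 : ((c • (1 : Matrix (Fin d) (Fin d) ℝ) - M).det : ℂ) =
      (complexify M).charpoly.eval (c : ℂ) := by
    rw [Matrix.eval_charpoly]
    have : Matrix.scalar (Fin d) (c : ℂ) - complexify M =
        (c • (1 : Matrix (Fin d) (Fin d) ℝ) - M).map (algebraMap ℝ ℂ) := by
      ext i j
      by_cases hij : i = j <;> simp [hij]
    rw [this]
    exact RingHom.map_det (algebraMap ℝ ℂ) _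
  have h2 : |(c • (1 : Matrix (Fin d) (Fin d) ℝ) - M).det| =
      ‖(complexify M).charpoly.eval (c : ℂ)‖ := by
    rw [← h1, Complex.norm_real, Real.norm_eq_abs]
  rw [h2, (IsAlgClosed.splits _).eval_eq_prod_roots_of_monic (Matrix.charpoly_monic _)]
  have hcard : (complexify M).charpoly.roots.card = d := by
    rw [← (IsAlgClosed.splits (complexify M).charpoly).natDegree_eq_card_roots,
      Matrix.charpoly_natDegree_eq_dim, Fintype.card_fin]
  have hn : ∀ s : Multiset ℂ, (∀ x ∈ s, ‖x‖ ≤ g) →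
      (|c| - g) ^ s.card ≤ ‖(s.map fun x => (c : ℂ) - x).prod‖ := by
    intro s
    induction s using Multiset.induction with
    | empty => simp
    | cons a s ih =>
      intro hs
      rw [Multiset.map_cons, Multiset.prod_cons, Multiset.card_cons, norm_mul, pow_succ, mul_comm]
      have h3 := ih fun x hx => hs x (Multiset.mem_cons_of_mem hx)
      have h4 : |c| - g ≤ ‖(c : ℂ) - a‖ := by
        have := norm_sub_norm_le (c : ℂ) a
        rw [Complex.norm_real, Real.norm_eq_abs] at this
        linarith [hs a (Multiset.mem_cons_self a s)]
      exact mul_le_mul h4 h3 (pow_nonneg (by linarith) _) (norm_nonneg _)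
  have := hn (complexify M).charpoly.roots fun x hx =>
    (norm_le_specRad (Polynomial.isRoot_of_mem_roots hx)).trans h
  rwa [hcard] at this

lemma abs_trace_le [NeZero d] (M : Matrix (Fin d) (Fin d) ℝ) : |M.trace| ≤ d * specRad M := by
  have h1 : (M.trace : ℂ) = (complexify M).trace :=
    AddMonoidHom.map_trace (algebraMap ℝ ℂ).toAddMonoidHom M
  have h2 : |M.trace| = ‖(complexify M).charpoly.roots.sum‖ := by
    rw [← Matrix.trace_eq_sum_roots_charpoly, ← h1, Complex.norm_real, Real.norm_eq_abs]
  have hcard : (complexify M).charpoly.roots.card = d := by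
    rw [← (IsAlgClosed.splits (complexify M).charpoly).natDegree_eq_card_roots,
      Matrix.charpoly_natDegree_eq_dim, Fintype.card_fin]
  have h3 := Multiset.le_sum_of_subadditive (norm : ℂ → ℝ) norm_zero.le norm_add_le
    (complexify M).charpoly.roots
  have h4 := Multiset.sum_le_card_nsmul ((complexify M).charpoly.roots.map norm) (specRad M) (by
    intro x hx
    obtain ⟨y, hy, rfl⟩ := Multiset.mem_map.1 hx
    exact norm_le_specRad (Polynomial.isRoot_of_mem_roots hy))
  rw [Multiset.card_map, hcard, nsmul_eq_mul] at h4
  rw [h2]; exact h3.trans h4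

end Spectral

/-! ### Powers of a matrix with a simple leading eigenvalue -/

section RankOneLimit

open Filter Topology

variable {d : ℕ} {M : Matrix (Fin d) (Fin d) ℝ} {v f : Fin d → ℝ}

lemma complexify_mulVec_ofReal (M : Matrix (Fin d) (Fin d) ℝ) (x : Fin d → ℝ) :
    complexify M *ᵥ (fun i => (x i : ℂ)) = fun i => ((M *ᵥ x) i : ℂ) := by
  ext i
  simp [Matrix.mulVec, dotProduct]

lemma dotProduct_mulVec_of_adjoint (hf : Mᵀ *ᵥ f = f) (x : Fin d → ℝ) :
    f ⬝ᵥ (M *ᵥ x) = f ⬝ᵥ x := by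
  rw [Matrix.dotProduct_mulVec, ← Matrix.mulVec_transpose, hf]

lemma ofReal_dotProduct_complexify_mulVec (hf : Mᵀ *ᵥ f = f) (z : Fin d → ℂ) :
    (fun i => (f i : ℂ)) ⬝ᵥ (complexify M *ᵥ z) = (fun i => (f i : ℂ)) ⬝ᵥ z := by
  have h0 : (complexify M)ᵀ = complexify Mᵀ := by ext i j; simp
  rw [Matrix.dotProduct_mulVec, ← Matrix.mulVec_transpose, h0, complexify_mulVec_ofReal, hf]

lemma dotProduct_pow_mulVec_of_adjoint (hf : Mᵀ *ᵥ f = f) (k : ℕ) (x : Fin d → ℝ) :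
    f ⬝ᵥ (M ^ k *ᵥ x) = f ⬝ᵥ x := by
  induction k with
  | zero => simp
  | succ k ih => rw [pow_succ', ← Matrix.mulVec_mulVec, dotProduct_mulVec_of_adjoint hf, ih]

lemma pow_mulVec_of_fixed (hv : M *ᵥ v = v) (k : ℕ) : M ^ k *ᵥ v = v := by
  simpa using pow_mulVec_of_eigen (μ := (1 : ℝ)) (by simpa using hv) k

lemma sub_vecMulVec_mulVec (x : Fin d → ℝ) :
    (M - Matrix.vecMulVec v f) *ᵥ x = M *ᵥ x - (f ⬝ᵥ x) • v := by
  rw [Matrix.sub_mulVec, Matrix.vecMulVec_mulVec]; simp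

lemma sub_vecMulVec_pow_mulVec (hv : M *ᵥ v = v) (hf : Mᵀ *ᵥ f = f) (hfv : f ⬝ᵥ v = 1) (k : ℕ)
    (x : Fin d → ℝ) :
    (M - Matrix.vecMulVec v f) ^ (k + 1) *ᵥ x = M ^ (k + 1) *ᵥ x - (f ⬝ᵥ x) • v := by
  induction k with
  | zero => simp [sub_vecMulVec_mulVec]
  | succ k ih =>
    rw [pow_succ', ← Matrix.mulVec_mulVec, ih, sub_vecMulVec_mulVec, Matrix.mulVec_sub,
      Matrix.mulVec_smul, hv, dotProduct_sub, dotProduct_pow_mulVec_of_adjoint hf, dotProduct_smul,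
      hfv, Matrix.mulVec_mulVec, ← pow_succ']
    simp

/-- If the leading eigenvalue `1` of `M` is unique and simple, then the powers of `M` converge to
the rank one projection `x ↦ (f, x) v`: the matrix `M - v fᵀ` has spectral radius less than one. -/
lemma exists_pow_mulVec_sub_le [NeZero d] (hs : UniqueSimpleLeadingEigenvalue M)
    (hρ : specRad M = 1) (hv : M *ᵥ v = v) (hf : Mᵀ *ᵥ f = f) (hfv : f ⬝ᵥ v = 1) {ε : ℝ}
    (hε : 0 < ε) :
    ∃ N : ℕ, ∀ k ≥ N, ∀ x, ‖M ^ k *ᵥ x - (f ⬝ᵥ x) • v‖ ≤ ε * ‖x‖ := by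
  set Q := M - Matrix.vecMulVec v f with hQ
  let fc : Fin d → ℂ := fun i => f i
  let vc : Fin d → ℂ := fun i => v i
  have hQc : ∀ z, complexify Q *ᵥ z = complexify M *ᵥ z - (fc ⬝ᵥ z) • vc := by
    intro z
    have : complexify Q = complexify M - Matrix.vecMulVec vc fc := by
      ext i j; simp [hQ, Matrix.vecMulVec_apply, vc, fc]
    rw [this, Matrix.sub_mulVec, Matrix.vecMulVec_mulVec]; simp
  have hvc : complexify M *ᵥ vc = (1 : ℂ) • vc := by
    rw [one_smul, complexify_mulVec_ofReal, hv]
  have hfvc : fc ⬝ᵥ vc = 1 := by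
    have : ((f ⬝ᵥ v : ℝ) : ℂ) = fc ⬝ᵥ vc := by simp [dotProduct, fc, vc]
    rw [← this, hfv]; simp
  have hfc : ∀ z, fc ⬝ᵥ (complexify M *ᵥ z) = fc ⬝ᵥ z := ofReal_dotProduct_complexify_mulVec hf
  have hvc0 : vc ≠ 0 := by rintro h; rw [h] at hfvc; simp at hfvc
  have hroot1 : (complexify M).charpoly.IsRoot 1 := (isRoot_charpoly_iff _ _).2 ⟨vc, hvc0, hvc⟩
  obtain ⟨μ₀, h1, h2, h3⟩ := hs
  obtain rfl : (1 : ℂ) = μ₀ := h3 1 hroot1 (by simp [hρ])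
  have hQρ : specRad Q < 1 := by
    obtain ⟨μ, hμ, hn⟩ := exists_isRoot_norm_eq_specRad Q
    by_contra! hge
    obtain ⟨z, hz, hez⟩ := (isRoot_charpoly_iff _ _).1 hμ
    rw [hQc] at hez
    -- the functional `f` annihilates the range of `Q`
    have hμf : μ * (fc ⬝ᵥ z) = 0 := by
      have := congrArg (fc ⬝ᵥ ·) hez
      simp only [dotProduct_sub, dotProduct_smul, hfvc, hfc] at this
      simpa using this.symm
    have hμ0 : μ ≠ 0 := by rintro rfl; rw [norm_zero] at hn; linarith
    have hfz : fc ⬝ᵥ z = 0 := by simpa [hμ0] using hμf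
    rw [hfz, zero_smul, sub_zero] at hez
    have hMr : (complexify M).charpoly.IsRoot μ := (isRoot_charpoly_iff _ _).2 ⟨z, hz, hez⟩
    have hμ1 : μ = 1 := h3 μ hMr (by
      refine le_antisymm (norm_le_specRad hMr) ?_
      rw [hρ, hn]; exact hge)
    rw [hμ1] at hez
    have hfin :
        Module.finrank ℂ (Module.End.maxGenEigenspace (Matrix.toLin' (complexify M)) 1) = 1 := by
      rw [← rootMultiplicity_charpoly_eq, h2]
    have hmem : ∀ z, complexify M *ᵥ z = (1 : ℂ) • z →
        z ∈ Module.End.maxGenEigenspace (Matrix.toLin' (complexify M)) 1 := by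
      intro z h
      rw [Module.End.mem_maxGenEigenspace]
      refine ⟨1, ?_⟩
      simp only [pow_one, LinearMap.sub_apply, Matrix.toLin'_apply, h]
      simp
    obtain ⟨c, hc⟩ := (finrank_eq_one_iff_of_nonzero' (⟨vc, hmem vc hvc⟩ :
      Module.End.maxGenEigenspace (Matrix.toLin' (complexify M)) 1)
      (by simpa [Subtype.ext_iff] using hvc0)).1 hfin ⟨z, hmem z hez⟩
    have hc' : c • vc = z := congrArg Subtype.val hc
    rw [← hc', dotProduct_smul, hfvc] at hfz
    apply hz
    rw [← hc', show c = 0 by simpa using hfz, zero_smul]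
  obtain ⟨N, hN⟩ := exists_pow_mulVec_le hQρ hε
  refine ⟨N + 1, fun k hk x => ?_⟩
  obtain ⟨k, rfl⟩ : ∃ j, k = j + 1 := ⟨k - 1, by omega⟩
  rw [← sub_vecMulVec_pow_mulVec hv hf hfv]
  exact hN _ (by omega) x

/-- Conversely, if a subsequence of the powers of `M` converges to a rank one projection, then the
leading eigenvalue of `M` is unique and simple. -/
lemma uniqueSimpleLeadingEigenvalue_of_tendsto [NeZero d] (hρ : specRad M = 1) (hv : M *ᵥ v = v)
    (hf : Mᵀ *ᵥ f = f) (hfv : f ⬝ᵥ v = 1) {N : ℕ}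
    (h : ∀ x, Tendsto (fun k : ℕ => M ^ (N * k) *ᵥ x) atTop (𝓝 ((f ⬝ᵥ x) • v))) :
    UniqueSimpleLeadingEigenvalue M := by
  let fc : Fin d → ℂ := fun i => f i
  let vc : Fin d → ℂ := fun i => v i
  have hvc : complexify M *ᵥ vc = vc := by
    rw [complexify_mulVec_ofReal, hv]
  have hfvc : fc ⬝ᵥ vc = 1 := by
    have : ((f ⬝ᵥ v : ℝ) : ℂ) = fc ⬝ᵥ vc := by simp [dotProduct, fc, vc]
    rw [← this, hfv]; simp
  have hfc : ∀ z, fc ⬝ᵥ (complexify M *ᵥ z) = fc ⬝ᵥ z := ofReal_dotProduct_complexify_mulVec hf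
  have hvc0 : vc ≠ 0 := by rintro h; rw [h] at hfvc; simp at hfvc
  have hlim : ∀ z, Tendsto (fun k : ℕ => complexify M ^ (N * k) *ᵥ z) atTop
      (𝓝 ((fc ⬝ᵥ z) • vc)) := by
    intro z
    have hre := h fun j => (z j).re
    have him := h fun j => (z j).im
    rw [tendsto_pi_nhds] at hre him ⊢
    intro i
    have h1 := ((Complex.continuous_ofReal.tendsto _).comp (hre i)).add
      (((Complex.continuous_ofReal.tendsto _).comp (him i)).mul_const Complex.I)
    convert h1 using 1
    · ext k
      rw [← complexify_pow]
      simp only [Function.comp]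
      rw [← re_complexify_mulVec, ← im_complexify_mulVec, Complex.re_add_im]
    · congr 1
      apply Complex.ext <;>
      simp [dotProduct, fc, vc, Complex.re_sum, Complex.im_sum]
  have hfix : ∀ z, complexify M *ᵥ z = z → z = (fc ⬝ᵥ z) • vc := by
    intro z hz
    refine tendsto_nhds_unique ?_ (hlim z)
    have : ∀ k : ℕ, complexify M ^ (N * k) *ᵥ z = z := fun k => by
      simpa using pow_mulVec_of_eigen (μ := (1 : ℂ)) (by simpa using hz) (N * k)
    simp only [this]
    exact tendsto_const_nhds
  refine ⟨1, by simp [hρ], ?_, ?_⟩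
  · change (complexify M).charpoly.rootMultiplicity 1 = 1
    rw [rootMultiplicity_charpoly_eq]
    have hspan : ∀ k z,
        ((Matrix.toLin' (complexify M) - (1 : ℂ) • 1 : Module.End ℂ (Fin d → ℂ)) ^ k) z = 0 →
        ∃ c : ℂ, c • vc = z := by
      intro k
      induction k with
      | zero => intro z hz; exact ⟨0, by simpa using hz.symm⟩
      | succ k ih =>
        intro z hz
        rw [pow_succ, Module.End.mul_apply] at hz
        obtain ⟨c, hc⟩ := ih _ hz
        have hsub : (Matrix.toLin' (complexify M) - (1 : ℂ) • 1 : Module.End ℂ (Fin d → ℂ)) z =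
            complexify M *ᵥ z - z := by
          simp
        rw [hsub] at hc
        -- applying `f` shows that `c = 0`
        have hc0 : c = 0 := by
          have := congrArg (fc ⬝ᵥ ·) hc
          simpa [dotProduct_sub, dotProduct_smul, hfvc, hfc] using this
        rw [hc0, zero_smul, eq_comm, sub_eq_zero] at hc
        exact ⟨_, (hfix z hc).symm⟩
    have hmem : vc ∈ Module.End.maxGenEigenspace (Matrix.toLin' (complexify M)) 1 := by
      rw [Module.End.mem_maxGenEigenspace]
      exact ⟨1, by simp [hvc]⟩
    refine (finrank_eq_one_iff_of_nonzero' (⟨vc, hmem⟩ :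
      Module.End.maxGenEigenspace (Matrix.toLin' (complexify M)) 1)
      (by simpa [Subtype.ext_iff] using hvc0)).2 ?_
    rintro ⟨z, hz⟩
    obtain ⟨k, hk⟩ := (Module.End.mem_maxGenEigenspace _ _ _).1 hz
    obtain ⟨c, hc⟩ := hspan k z hk
    exact ⟨c, Subtype.ext hc⟩
  · intro ν hν hn
    obtain ⟨z, hz, hez⟩ := (isRoot_charpoly_iff _ _).1 hν
    rw [hρ] at hn
    have h1 : ν * (fc ⬝ᵥ z) = fc ⬝ᵥ z := by
      rw [← hfc z]
      have := congrArg (fc ⬝ᵥ ·) hez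
      simp only [dotProduct_smul, smul_eq_mul] at this
      rw [hfc] at this ⊢
      exact this.symm
    by_contra hne
    have hfz : fc ⬝ᵥ z = 0 := by
      have : (ν - 1) * (fc ⬝ᵥ z) = 0 := by rw [sub_mul, h1]; ring
      exact (mul_eq_zero.1 this).resolve_left (sub_ne_zero.2 hne)
    have h2 := (hlim z).norm
    rw [hfz, zero_smul, norm_zero] at h2
    have h3 : ∀ k : ℕ, ‖complexify M ^ (N * k) *ᵥ z‖ = ‖z‖ := fun k => by
      rw [pow_mulVec_of_eigen hez, norm_smul, norm_pow, hn, one_pow, one_mul]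
    simp only [h3] at h2
    exact hz (norm_eq_zero.1 (tendsto_nhds_unique tendsto_const_nhds h2))

/-- A power bounded matrix has no Jordan block at the eigenvalue `1`, so a fixed vector can be
normalized against a fixed vector of the adjoint. -/
lemma exists_adjoint_fixed (hv : M *ᵥ v = v) (hv0 : v ≠ 0)
    (hb : ∀ x, ∃ C, ∀ k : ℕ, ‖M ^ k *ᵥ x‖ ≤ C) : ∃ f, Mᵀ *ᵥ f = f ∧ f ⬝ᵥ v = 1 := by
  have hnot : v ∉ LinearMap.range (Matrix.toLin' (M - 1)) := by
    rintro ⟨z, hz⟩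
    rw [Matrix.toLin'_apply, Matrix.sub_mulVec, Matrix.one_mulVec, sub_eq_iff_eq_add] at hz
    have hk : ∀ k : ℕ, M ^ k *ᵥ z = (k : ℝ) • v + z := by
      intro k
      induction k with
      | zero => simp
      | succ k ih =>
        rw [pow_succ', ← Matrix.mulVec_mulVec, ih, Matrix.mulVec_add, Matrix.mulVec_smul, hv, hz]
        push_cast; module
    obtain ⟨C, hC⟩ := hb z
    obtain ⟨k, hk'⟩ := exists_nat_gt ((C + ‖z‖) / ‖v‖)
    have hvn : 0 < ‖v‖ := norm_pos_iff.2 hv0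
    rw [div_lt_iff₀ hvn] at hk'
    have h1 := hC k
    rw [hk] at h1
    have h2 := norm_sub_le ((k : ℝ) • v + z) z
    rw [add_sub_cancel_right, norm_smul, Real.norm_of_nonneg (by positivity)] at h2
    linarith
  obtain ⟨φ, hφv, hφ⟩ := Submodule.exists_le_ker_of_notMem hnot
  let g : Fin d → ℝ := fun i => φ (Pi.single i 1)
  have hg : ∀ x, g ⬝ᵥ x = φ x := by
    intro x
    have : x = ∑ i, x i • (Pi.single i 1 : Fin d → ℝ) := by
      ext j; simp [Pi.single_apply]
    conv_rhs => rw [this]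
    simp [dotProduct, g, mul_comm]
  refine ⟨(φ v)⁻¹ • g, ?_, ?_⟩
  · rw [Matrix.mulVec_smul]
    congr 1
    refine dotProduct_eq _ _ fun x => ?_
    rw [Matrix.mulVec_transpose, ← Matrix.dotProduct_mulVec, hg, hg]
    have : φ ((M - 1) *ᵥ x) = 0 := hφ ⟨x, Matrix.toLin'_apply _ _⟩
    rw [Matrix.sub_mulVec, Matrix.one_mulVec, map_sub, sub_eq_zero] at this
    exact this
  · rw [smul_dotProduct, hg, smul_eq_mul, inv_mul_cancel₀ hφv]

end RankOneLimit

/-! ### Products along words -/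

section WordProd

variable {d m : ℕ} (A : Fin m → Matrix (Fin d) (Fin d) ℝ)

@[simp] lemma wordProd_nil : wordProd A [] = 1 := by simp [wordProd]

lemma wordProd_append (u w : List (Fin m)) :
    wordProd A (u ++ w) = wordProd A w * wordProd A u := by simp [wordProd]

lemma wordProd_cons (s : Fin m) (w : List (Fin m)) :
    wordProd A (s :: w) = wordProd A w * A s := by simp [wordProd]

lemma wordProd_append_mulVec (u w : List (Fin m)) (x : Fin d → ℝ) :
    wordProd A (u ++ w) *ᵥ x = wordProd A w *ᵥ (wordProd A u *ᵥ x) := by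
  rw [wordProd_append, Matrix.mulVec_mulVec]

lemma wordProd_cons_mulVec (s : Fin m) (w : List (Fin m)) (x : Fin d → ℝ) :
    wordProd A (s :: w) *ᵥ x = wordProd A w *ᵥ (A s *ᵥ x) := by
  rw [wordProd_cons, Matrix.mulVec_mulVec]

lemma wordProd_flatten_replicate (k : ℕ) (w : List (Fin m)) :
    wordProd A (List.replicate k w).flatten = wordProd A w ^ k := by
  induction k with
  | zero => simp
  | succ k ih => rw [List.replicate_succ, List.flatten_cons, wordProd_append, ih, pow_succ]

lemma wordProd_normalizedFamily (c : ℝ) (w : List (Fin m)) :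
    wordProd (normalizedFamily A c) w = (c⁻¹) ^ w.length • wordProd A w := by
  induction w with
  | nil => simp
  | cons s w ih =>
    rw [wordProd_cons, wordProd_cons, ih, normalizedFamily, List.length_cons, pow_succ,
      smul_mul_smul_comm]

end WordProd

/-! ### Boundedness of irreducible semigroups with bounded traces -/

section Bounded

variable {d m : ℕ}

open Polynomial in
/-- A matrix all of whose powers have trace zero does not have the eigenvalue `1`: otherwise a
polynomial in it would be a nonzero idempotent of trace zero. -/
lemma eq_zero_of_trace_pow_eq_zero {Z : Matrix (Fin d) (Fin d) ℝ}
    (hZ : ∀ k : ℕ, (Z ^ (k + 1)).trace = 0) {x : Fin d → ℝ} (hx : Z *ᵥ x = x) : x = 0 := by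
  by_contra hx0
  have heval : ∀ p : ℝ[X], aeval Z p *ᵥ x = p.eval 1 • x := by
    intro p
    induction p using Polynomial.induction_on' with
    | add p q hp hq => rw [map_add, Matrix.add_mulVec, hp, hq, eval_add, add_smul]
    | monomial n a =>
      rw [aeval_monomial, ← Algebra.smul_def, Matrix.smul_mulVec, pow_mulVec_of_fixed hx]
      simp
  have htr : ∀ p : ℝ[X], (aeval Z (p * X)).trace = 0 := by
    intro p
    induction p using Polynomial.induction_on' with
    | add p q hp hq => rw [add_mul, map_add, Matrix.trace_add, hp, hq, add_zero]
    | monomial n a =>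
      rw [monomial_mul_X, aeval_monomial, ← Algebra.smul_def, Matrix.trace_smul, hZ, smul_zero]
  obtain ⟨h, hh, hdvd⟩ := Polynomial.exists_eq_pow_rootMultiplicity_mul_and_not_dvd Z.charpoly
    (Matrix.charpoly_monic Z).ne_zero 0
  set a := Z.charpoly.rootMultiplicity 0
  rw [C_0, sub_zero] at hh hdvd
  obtain ⟨u, w, huw⟩ : IsCoprime (X ^ (a + 1)) h :=
    (((Polynomial.irreducible_X).coprime_iff_not_dvd).2 hdvd).pow_left
  have hid : IsIdempotentElem (aeval Z (u * X ^ (a + 1))) := by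
    have h1 : u * X ^ (a + 1) * (u * X ^ (a + 1)) =
        u * X ^ (a + 1) - u * w * X * Z.charpoly := by
      have : u * X ^ (a + 1) = 1 - w * h := by rw [← huw]; ring
      calc _ = u * X ^ (a + 1) * (1 - w * h) := by rw [this]
        _ = u * X ^ (a + 1) - u * w * X * (X ^ a * h) := by ring
        _ = _ := by rw [← hh]
    rw [IsIdempotentElem, ← map_mul, h1, map_sub, map_mul _ _ Z.charpoly,
      Matrix.aeval_self_charpoly, mul_zero, sub_zero]
  have h0 : aeval Z (u * X ^ (a + 1)) = 0 := by
    have h2 : (aeval Z (u * X ^ (a + 1))).trace = 0 := by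
      rw [pow_succ, ← mul_assoc]; exact htr _
    have h3 := LinearMap.IsIdempotentElem.eq_zero_of_trace_eq_zero
      (e := Matrix.toLin' (aeval Z (u * X ^ (a + 1))))
      (by rw [IsIdempotentElem, Module.End.mul_eq_comp, ← Matrix.toLin'_mul, hid.eq])
      (by rw [Matrix.trace_toLin'_eq, h2])
    exact Matrix.toLin'.map_eq_zero_iff.1 h3
  have hroot : Z.charpoly.eval 1 = 0 := by
    have := heval Z.charpoly
    rw [Matrix.aeval_self_charpoly, Matrix.zero_mulVec, eq_comm, smul_eq_zero] at this
    exact this.resolve_right hx0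
  have hh1 : h.eval 1 = 0 := by rw [hh] at hroot; simpa using hroot
  have hu1 := congrArg (eval 1) huw
  have h4 := heval (u * X ^ (a + 1))
  rw [h0, Matrix.zero_mulVec, eq_comm, smul_eq_zero] at h4
  have h5 := h4.resolve_right hx0
  simp only [eval_add, eval_mul, eval_pow, eval_X, one_pow, mul_one, hh1, mul_zero, add_zero,
    eval_one] at hu1 h5
  rw [h5] at hu1
  exact zero_ne_one hu1

variable {A : Fin m → Matrix (Fin d) (Fin d) ℝ}

/-- The linear span of all products of matrices of the family. -/
def wordSpan (A : Fin m → Matrix (Fin d) (Fin d) ℝ) : Submodule ℝ (Matrix (Fin d) (Fin d) ℝ) :=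
  Submodule.span ℝ (Set.range (wordProd A))

lemma wordProd_mem_wordSpan (w : List (Fin m)) : wordProd A w ∈ wordSpan A :=
  Submodule.subset_span ⟨w, rfl⟩

lemma mul_mem_wordSpan {X Y : Matrix (Fin d) (Fin d) ℝ} (hX : X ∈ wordSpan A)
    (hY : Y ∈ wordSpan A) : X * Y ∈ wordSpan A := by
  have h : wordSpan A * wordSpan A ≤ wordSpan A := by
    rw [wordSpan, Submodule.span_mul_span]
    refine Submodule.span_mono ?_
    rintro _ ⟨_, ⟨u, rfl⟩, _, ⟨w, rfl⟩, rfl⟩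
    exact ⟨w ++ u, wordProd_append A w u⟩
  exact h (Submodule.mul_mem_mul hX hY)

lemma pow_mem_wordSpan {X : Matrix (Fin d) (Fin d) ℝ} (hX : X ∈ wordSpan A) (k : ℕ) :
    X ^ k ∈ wordSpan A := by
  induction k with
  | zero => rw [pow_zero, ← wordProd_nil A]; exact wordProd_mem_wordSpan _
  | succ k ih => rw [pow_succ]; exact mul_mem_wordSpan ih hX

/-- For an irreducible family the trace form is nondegenerate on the algebra spanned by the
products. If `X` lies in its radical, then no `Y X` has the eigenvalue `1`, whereas irreducibility
gives `Y X x = x` for some `Y` as soon as `X x ≠ 0`. -/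
lemma eq_zero_of_trace_mul_eq_zero (hA : IrreducibleFamily A) {X : Matrix (Fin d) (Fin d) ℝ}
    (hX : X ∈ wordSpan A) (h : ∀ Y ∈ wordSpan A, (X * Y).trace = 0) : X = 0 := by
  have hno : ∀ Y ∈ wordSpan A, ∀ x, (Y * X) *ᵥ x = x → x = 0 := by
    intro Y hY x hx
    refine eq_zero_of_trace_pow_eq_zero (fun k => ?_) hx
    rw [pow_succ, ← mul_assoc, Matrix.trace_mul_comm]
    exact h _ (mul_mem_wordSpan (pow_mem_wordSpan (mul_mem_wordSpan hY hX) k) hY)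
  have hzero : ∀ x, X *ᵥ x = 0 := by
    intro x
    let g : Matrix (Fin d) (Fin d) ℝ →ₗ[ℝ] (Fin d → ℝ) :=
      { toFun := fun Y => Y *ᵥ (X *ᵥ x)
        map_add' := fun Y Z => Matrix.add_mulVec _ _ _
        map_smul' := fun c Y => Matrix.smul_mulVec _ _ _ }
    rcases hA ((wordSpan A).map g) (by
      rintro s _ ⟨Y, hY, rfl⟩
      refine ⟨A s * Y, mul_mem_wordSpan ?_ hY, (Matrix.mulVec_mulVec (X *ᵥ x) (A s) Y).symm⟩
      have := wordProd_mem_wordSpan (A := A) [s]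
      rwa [wordProd_cons, wordProd_nil, one_mul] at this) with hU | hU
    · have h1 : g 1 ∈ (wordSpan A).map g :=
        ⟨1, by rw [← wordProd_nil A]; exact wordProd_mem_wordSpan _, rfl⟩
      rw [hU, Submodule.mem_bot] at h1
      simpa [g] using h1
    · obtain ⟨Y, hY, hYx⟩ : x ∈ (wordSpan A).map g := by rw [hU]; trivial
      have : x = 0 := hno Y hY x ((Matrix.mulVec_mulVec _ _ _).symm.trans hYx)
      rw [this, Matrix.mulVec_zero]
  ext i j
  have := congrFun (hzero (Pi.single j 1)) i
  simpa using this

attribute [local instance] Matrix.linftyOpNormedRing Matrix.linftyOpNormedAlgebra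

/-- An irreducible family whose products have bounded traces generates a bounded semigroup. -/
lemma exists_bound_of_trace_bound (hA : IrreducibleFamily A) {C₀ : ℝ}
    (htr : ∀ w, |(wordProd A w).trace| ≤ C₀) :
    ∃ C, 0 < C ∧ ∀ w x, ‖wordProd A w *ᵥ x‖ ≤ C * ‖x‖ := by
  let b := Module.finBasis ℝ (wordSpan A)
  let Φ : wordSpan A →ₗ[ℝ] (Fin (Module.finrank ℝ (wordSpan A)) → ℝ) :=
    { toFun := fun X i => ((X : Matrix (Fin d) (Fin d) ℝ) * b i).trace
      map_add' := fun X Y => by ext i; simp [add_mul]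
      map_smul' := fun c X => by ext i; simp }
  have hker : LinearMap.ker Φ = ⊥ := by
    rw [LinearMap.ker_eq_bot']
    intro X hX
    refine Subtype.ext (eq_zero_of_trace_mul_eq_zero hA X.2 fun Y hY => ?_)
    let τ : wordSpan A →ₗ[ℝ] ℝ :=
      { toFun := fun Y => ((X : Matrix (Fin d) (Fin d) ℝ) * Y).trace
        map_add' := fun Y Z => by simp [mul_add]
        map_smul' := fun c Y => by simp }
    have hτ : τ = 0 := b.ext fun i => congrFun hX i
    exact LinearMap.congr_fun hτ ⟨Y, hY⟩
  obtain ⟨K, hK, hΦ⟩ := LinearMap.exists_antilipschitzWith Φ hker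
  have hbd : ∀ Y ∈ wordSpan A, ∃ C, ∀ w, |(wordProd A w * Y).trace| ≤ C := by
    intro Y hY
    induction hY using Submodule.span_induction with
    | mem Y hY =>
      obtain ⟨u, rfl⟩ := hY
      exact ⟨C₀, fun w => by rw [← wordProd_append]; exact htr _⟩
    | zero => exact ⟨0, fun w => by simp⟩
    | add Y Z _ _ hY hZ =>
      obtain ⟨C₁, h₁⟩ := hY
      obtain ⟨C₂, h₂⟩ := hZ
      refine ⟨C₁ + C₂, fun w => ?_⟩
      rw [mul_add, Matrix.trace_add]
      exact (abs_add_le _ _).trans (add_le_add (h₁ w) (h₂ w))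
    | smul c Y _ hY =>
      obtain ⟨C₁, h₁⟩ := hY
      refine ⟨|c| * C₁, fun w => ?_⟩
      rw [Matrix.mul_smul, Matrix.trace_smul, smul_eq_mul, abs_mul]
      exact mul_le_mul_of_nonneg_left (h₁ w) (abs_nonneg c)
  choose C hC using fun i => hbd (b i) (b i).2
  refine ⟨K * (∑ i, |C i|) + 1, by positivity, fun w x => ?_⟩
  have h1 := hΦ.le_mul_dist ⟨wordProd A w, wordProd_mem_wordSpan w⟩ 0
  rw [map_zero, dist_zero_right, dist_zero_right] at h1
  have h2 : ‖Φ ⟨wordProd A w, wordProd_mem_wordSpan w⟩‖ ≤ ∑ i, |C i| := by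
    refine (pi_norm_le_iff_of_nonneg (by positivity)).2 fun i => ?_
    refine (hC i w).trans ((le_abs_self _).trans ?_)
    exact Finset.single_le_sum (f := fun i => |C i|) (fun _ _ => abs_nonneg _) (Finset.mem_univ i)
  refine (Matrix.linfty_opNorm_mulVec _ _).trans (mul_le_mul_of_nonneg_right ?_ (norm_nonneg _))
  have h3 : ‖wordProd A w‖ ≤ K * (∑ i, |C i|) :=
    h1.trans (mul_le_mul_of_nonneg_left h2 K.2)
  linarith

/-- Approximate eigenvectors in a bounded set of matrices: if the spectral radius of `M` is less
than `g`, then `M` has no approximate eigenvalue of modulus larger than `g`, uniformly over all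
matrices `M` with `‖M x‖ ≤ C ‖x‖`. The adjugate of `c - M` bounds its inverse. -/
lemma exists_approx_eigen_bound [NeZero d] (C C₁ g h : ℝ) (hgh : g < h) :
    ∃ κ : ℝ, 0 < κ ∧ ∀ (M : Matrix (Fin d) (Fin d) ℝ) (c : ℝ), (∀ x, ‖M *ᵥ x‖ ≤ C * ‖x‖) →
      specRad M ≤ g → h ≤ |c| → |c| ≤ C₁ → ∀ x, κ * ‖x‖ ≤ ‖M *ᵥ x - c • x‖ := by
  have hcont : Continuous fun X : Matrix (Fin d) (Fin d) ℝ => ‖X.adjugate‖ :=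
    (Continuous.matrix_adjugate continuous_id).norm
  obtain ⟨D, hD⟩ := ((isCompact_closedBall (0 : Matrix (Fin d) (Fin d) ℝ)
    (C₁ + |C|)).image hcont).bddAbove
  refine ⟨(h - g) ^ d / (|D| + 1), div_pos (pow_pos (sub_pos.2 hgh) _) (by positivity),
    fun M c hM hρ hhc hcC x => ?_⟩
  set X := c • (1 : Matrix (Fin d) (Fin d) ℝ) - M with hXdef
  have hXn : ‖X‖ ≤ C₁ + |C| := by
    rw [Matrix.linfty_opNorm_eq_opNorm]
    refine ContinuousLinearMap.opNorm_le_bound _ (by linarith [abs_nonneg c, abs_nonneg C])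
      fun x => ?_
    change ‖X *ᵥ x‖ ≤ _
    rw [hXdef, Matrix.sub_mulVec, Matrix.smul_mulVec, Matrix.one_mulVec, add_mul]
    refine (norm_sub_le _ _).trans (add_le_add ?_ ((hM x).trans ?_))
    · rw [norm_smul]; exact mul_le_mul_of_nonneg_right hcC (norm_nonneg _)
    · exact mul_le_mul_of_nonneg_right (le_abs_self C) (norm_nonneg _)
  have hadj : ‖X.adjugate‖ ≤ |D| + 1 := by
    have := hD ⟨X, by simpa using hXn, rfl⟩
    linarith [le_abs_self D]
  have h1 : X.adjugate *ᵥ (X *ᵥ x) = X.det • x := by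
    rw [Matrix.mulVec_mulVec, Matrix.adjugate_mul, Matrix.smul_mulVec, Matrix.one_mulVec]
  have h2 := Matrix.linfty_opNorm_mulVec X.adjugate (X *ᵥ x)
  rw [h1, norm_smul, Real.norm_eq_abs] at h2
  have h3 : (h - g) ^ d ≤ |X.det| :=
    (pow_le_pow_left₀ (sub_nonneg.2 hgh.le) (by linarith) d).trans
      (pow_sub_le_abs_det hρ (by linarith))
  have h4 : ‖M *ᵥ x - c • x‖ = ‖X *ᵥ x‖ := by
    rw [hXdef, Matrix.sub_mulVec, Matrix.smul_mulVec, Matrix.one_mulVec, norm_sub_rev]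
  rw [h4, div_mul_eq_mul_div, div_le_iff₀ (by positivity)]
  calc (h - g) ^ d * ‖x‖ ≤ |X.det| * ‖x‖ := mul_le_mul_of_nonneg_right h3 (norm_nonneg _)
    _ ≤ _ := h2
    _ ≤ (|D| + 1) * ‖X *ᵥ x‖ := mul_le_mul_of_nonneg_right hadj (norm_nonneg _)
    _ = _ := mul_comm _ _

end Bounded

/-! ### Symmetrized convex hulls -/

section Absco

open scoped Pointwise

variable {d : ℕ} {V V' K : Set (Fin d → ℝ)}

lemma subset_absco (V : Set (Fin d → ℝ)) : V ⊆ absco V :=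
  Set.subset_union_left.trans (subset_convexHull ℝ _)

lemma convex_absco (V : Set (Fin d → ℝ)) : Convex ℝ (absco V) := convex_convexHull ℝ _

lemma absco_mono (h : V ⊆ V') : absco V ⊆ absco V' :=
  convexHull_mono (Set.union_subset_union h (Set.image_mono h))

lemma mulVec_mem_of_mem_absco (M : Matrix (Fin d) (Fin d) ℝ) (hK : Convex ℝ K)
    (hneg : ∀ y ∈ K, -y ∈ K) (h : ∀ x ∈ V, M *ᵥ x ∈ K) {x : Fin d → ℝ} (hx : x ∈ absco V) :
    M *ᵥ x ∈ K := by
  have : absco V ⊆ (Matrix.mulVecLin M) ⁻¹' K := by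
    refine convexHull_min ?_ (hK.linear_preimage _)
    rintro y (hy | ⟨y, hy, rfl⟩)
    · exact h y hy
    · change M *ᵥ (-y) ∈ K
      rw [Matrix.mulVec_neg]
      exact hneg _ (h y hy)
  exact this hx

lemma neg_mem_absco {x : Fin d → ℝ} (hx : x ∈ absco V) : -x ∈ absco V := by
  have : absco V ⊆ (-LinearMap.id : (Fin d → ℝ) →ₗ[ℝ] Fin d → ℝ) ⁻¹' absco V := by
    refine convexHull_min ?_ ((convex_absco V).linear_preimage _)
    rintro y (hy | ⟨y, hy, rfl⟩)
    · exact subset_convexHull ℝ _ (Or.inr ⟨y, hy, rfl⟩)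
    · simpa using subset_absco V hy
  exact this hx

lemma isCompact_absco (hV : V.Finite) : IsCompact (absco V) :=
  (hV.union (hV.image _)).isCompact_convexHull ℝ

lemma absco_subset_span (V : Set (Fin d → ℝ)) : absco V ⊆ Submodule.span ℝ V := by
  refine convexHull_min ?_ (Submodule.convex _)
  rintro y (hy | ⟨y, hy, rfl⟩)
  · exact Submodule.subset_span hy
  · exact neg_mem (Submodule.subset_span hy)

lemma span_eq_top_of_interior_nonempty (h : (interior (absco V)).Nonempty) :
    Submodule.span ℝ V = ⊤ :=
  Submodule.eq_top_of_nonempty_interior' _ (h.mono (interior_mono (absco_subset_span V)))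

lemma zero_mem_interior_absco [NeZero d] (h : Submodule.span ℝ V = ⊤) :
    (0 : Fin d → ℝ) ∈ interior (absco V) := by
  have hne : V.Nonempty := by
    rw [Set.nonempty_iff_ne_empty]
    rintro rfl
    rw [Submodule.span_empty] at h
    exact bot_ne_top h
  obtain ⟨y, hy⟩ := hne
  have h0 : (0 : Fin d → ℝ) ∈ affineSpan ℝ (V ∪ (fun x => -x) '' V) := by
    refine convexHull_subset_affineSpan _ ?_
    have := (convex_absco V) (subset_absco V hy) (neg_mem_absco (subset_absco V hy))
      (a := 1 / 2) (b := 1 / 2) (by norm_num) (by norm_num) (by norm_num)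
    rwa [smul_neg, add_neg_cancel] at this
  have htop : affineSpan ℝ (V ∪ (fun x => -x) '' V) = ⊤ := by
    rw [← affineSpan_insert_eq_affineSpan ℝ h0]
    apply SetLike.coe_injective
    rw [affineSpan_insert_zero, AffineSubspace.top_coe, ← Submodule.top_coe (R := ℝ)]
    congr 1
    rw [eq_top_iff, ← h]
    exact Submodule.span_mono Set.subset_union_left
  obtain ⟨z, hz⟩ := interior_convexHull_nonempty_iff_affineSpan_eq_top.2 htop
  have hz' : -z ∈ absco V := neg_mem_absco (interior_subset hz)
  have := (convex_absco V).combo_self_interior_mem_interior hz' hz (a := 1 / 2) (b := 1 / 2)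
    (by norm_num) (by norm_num) (by norm_num)
  simpa using this

/-- A nonzero set that is mapped into itself by an irreducible family, or whose symmetrized convex
hull has interior points, spans the whole space. -/
lemma span_eq_top_of_invariant {m : ℕ} {A : Fin m → Matrix (Fin d) (Fin d) ℝ}
    (hA : IrreducibleFamily A) {x₀ : Fin d → ℝ} (hx₀ : x₀ ∈ V) (hne : x₀ ≠ 0)
    (h : ∀ x ∈ V, ∀ s, A s *ᵥ x ∈ V ∨ (interior (absco V)).Nonempty) :
    Submodule.span ℝ V = ⊤ := by
  by_cases hint : (interior (absco V)).Nonempty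
  · exact span_eq_top_of_interior_nonempty hint
  · refine (hA (Submodule.span ℝ V) fun s x hx => ?_).resolve_left fun hbot => ?_
    · have : Submodule.span ℝ V ≤ (Submodule.span ℝ V).comap (Matrix.mulVecLin (A s)) :=
        Submodule.span_le.2 fun y hy =>
          Submodule.subset_span ((h y hy s).resolve_right hint)
      exact this hx
    · have : x₀ ∈ Submodule.span ℝ V := Submodule.subset_span hx₀
      rw [hbot, Submodule.mem_bot] at this
      exact hne this

end Absco

/-! ### Invariants of the algorithm -/

section Algorithm

variable {d m r : ℕ}

lemma testPoint_cases (S : Finset (Fin d → ℝ) × Finset (Fin d → ℝ)) (x : Fin d → ℝ) :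
    (x ∈ interior (absco (S.1 : Set (Fin d → ℝ))) ∧ testPoint S x = S) ∨
      (x ∉ interior (absco (S.1 : Set (Fin d → ℝ))) ∧
        (∀ y, y ∈ (testPoint S x).1 ↔ y = x ∨ y ∈ S.1) ∧
        (∀ y, y ∈ (testPoint S x).2 ↔ y = x ∨ y ∈ S.2)) := by
  classical
  by_cases h : x ∈ interior (absco (S.1 : Set (Fin d → ℝ)))
  · exact Or.inl ⟨h, if_pos h⟩
  · refine Or.inr ⟨h, ?_⟩
    rw [testPoint, if_neg h]
    exact ⟨fun y => Finset.mem_insert, fun y => Finset.mem_insert⟩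

/-- The invariants of one iteration: the sets grow, new points of the first set belong to the second,
every processed point is either added or finally interior, and only processed points that were not
interior to the initial polytope are added. -/
lemma foldl_testPoint (L : List (Fin d → ℝ)) (S : Finset (Fin d → ℝ) × Finset (Fin d → ℝ)) :
    S.1 ⊆ (L.foldl testPoint S).1 ∧ S.2 ⊆ (L.foldl testPoint S).2 ∧
    (∀ x ∈ (L.foldl testPoint S).1, x ∈ S.1 ∨ x ∈ (L.foldl testPoint S).2) ∧
    (∀ x ∈ L, x ∈ (L.foldl testPoint S).2 ∨
      x ∈ interior (absco ((L.foldl testPoint S).1 : Set (Fin d → ℝ)))) ∧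
    (∀ x ∈ (L.foldl testPoint S).2,
      x ∈ S.2 ∨ x ∈ L ∧ x ∉ interior (absco (S.1 : Set (Fin d → ℝ)))) ∧
    (S.2 ⊆ S.1 → (L.foldl testPoint S).2 ⊆ (L.foldl testPoint S).1) := by
  induction L generalizing S with
  | nil => exact ⟨subset_rfl, subset_rfl, fun _ h => Or.inl h, by simp, fun _ h => Or.inl h, id⟩
  | cons x L ih =>
    obtain ⟨h1, h2, h3, h4, h5, h6⟩ := ih (testPoint S x)
    rw [List.foldl_cons]
    rcases testPoint_cases S x with ⟨hx, he⟩ | ⟨hx, hV, hR⟩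
    · rw [he] at h1 h2 h3 h4 h5 h6 ⊢
      refine ⟨h1, h2, h3, ?_, ?_, h6⟩
      · intro y hy
        rcases List.mem_cons.1 hy with rfl | hy
        · exact Or.inr (interior_mono (absco_mono (by exact_mod_cast h1)) hx)
        · exact h4 y hy
      · intro y hy
        exact (h5 y hy).imp_right fun h => ⟨List.mem_cons_of_mem _ h.1, h.2⟩
    · have hVs : S.1 ⊆ (testPoint S x).1 := fun y hy => (hV y).2 (Or.inr hy)
      have hRs : S.2 ⊆ (testPoint S x).2 := fun y hy => (hR y).2 (Or.inr hy)
      refine ⟨hVs.trans h1, hRs.trans h2, ?_, ?_, ?_, ?_⟩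
      · intro y hy
        rcases h3 y hy with h | h
        · rcases (hV y).1 h with rfl | h
          · exact Or.inr (h2 ((hR y).2 (Or.inl rfl)))
          · exact Or.inl h
        · exact Or.inr h
      · intro y hy
        rcases List.mem_cons.1 hy with rfl | hy
        · exact Or.inl (h2 ((hR y).2 (Or.inl rfl)))
        · exact h4 y hy
      · intro y hy
        rcases h5 y hy with h | h
        · rcases (hR y).1 h with rfl | h
          · exact Or.inr ⟨List.mem_cons_self, hx⟩
          · exact Or.inl h
        · exact Or.inr ⟨List.mem_cons_of_mem _ h.1,
            fun hi => h.2 (interior_mono (absco_mono (by exact_mod_cast hVs)) hi)⟩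
      · intro hS
        refine h6 fun y hy => ?_
        rcases (hR y).1 hy with rfl | h
        · exact (hV y).2 (Or.inl rfl)
        · exact (hV y).2 (Or.inr (hS h))

/-- The `t`-th vector of the `i`-th root after balancing, with the index `t` read cyclically. -/
noncomputable def rootPt (A : Fin m → Matrix (Fin d) (Fin d) ℝ) (W : Fin r → List (Fin m))
    (v : Fin r → Fin d → ℝ) (α : Fin r → ℝ) (i : Fin r) (t : ℕ) : Fin d → ℝ :=
  α i • (wordProd A ((W i).take (t % (W i).length)) *ᵥ v i)

variable {A : Fin m → Matrix (Fin d) (Fin d) ℝ} {W : Fin r → List (Fin m)}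
  {v : Fin r → Fin d → ℝ} {α : Fin r → ℝ}

lemma rootPt_zero (i : Fin r) : rootPt A W v α i 0 = α i • v i := by simp [rootPt]

lemma rootPt_mod (i : Fin r) (t : ℕ) :
    rootPt A W v α i (t % (W i).length) = rootPt A W v α i t := by simp [rootPt]

lemma rootPt_eq_smul_rootVec (i : Fin r) (l : Fin (W i).length) :
    rootPt A W v α i l = α i • rootVec A (W i) (v i) l := by
  simp [rootPt, rootVec, Nat.mod_eq_of_lt l.2]

lemma mem_initialSet (hW : ∀ i, SimpleWord (W i)) {x : Fin d → ℝ} :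
    x ∈ initialSet A W v α ↔ ∃ i t, x = rootPt A W v α i t := by
  classical
  simp only [initialSet, Finset.mem_image, Finset.mem_univ, true_and]
  constructor
  · rintro ⟨p, rfl⟩
    exact ⟨p.1, p.2, (rootPt_eq_smul_rootVec _ _).symm⟩
  · rintro ⟨i, t, rfl⟩
    exact ⟨⟨i, ⟨t % (W i).length, Nat.mod_lt _ (hW i).length_pos⟩⟩, by
      rw [← rootPt_eq_smul_rootVec]; exact rootPt_mod i t⟩

lemma mem_rootChildren (hW : ∀ i, SimpleWord (W i)) {x : Fin d → ℝ} :
    x ∈ rootChildren A W v α ↔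
      ∃ i t s, some s ≠ cyc (W i) t ∧ x = A s *ᵥ rootPt A W v α i t := by
  classical
  simp only [rootChildren, Finset.mem_image, Finset.mem_univ, true_and, Finset.mem_filter]
  constructor
  · rintro ⟨⟨⟨i, l⟩, s⟩, hne, rfl⟩
    refine ⟨i, l, s, ?_, by rw [rootPt_eq_smul_rootVec]⟩
    rw [cyc_of_lt l.2, List.getElem?_eq_getElem l.2]
    simpa using hne
  · rintro ⟨i, t, s, hne, rfl⟩
    have hlt := Nat.mod_lt t (hW i).length_pos
    refine ⟨⟨⟨i, ⟨t % (W i).length, hlt⟩⟩, s⟩, ?_, ?_⟩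
    · rw [cyc, List.getElem?_eq_getElem hlt] at hne
      simpa using hne
    · rw [← rootPt_eq_smul_rootVec]; simp only [rootPt_mod]

lemma mulVec_rootPt (hW : ∀ i, SimpleWord (W i)) (hfix : ∀ i, wordProd A (W i) *ᵥ v i = v i)
    {i : Fin r} {t : ℕ} {s : Fin m} (h : some s = cyc (W i) t) :
    A s *ᵥ rootPt A W v α i t = rootPt A W v α i (t + 1) := by
  have hlt := Nat.mod_lt t (hW i).length_pos
  rw [cyc, List.getElem?_eq_getElem hlt, Option.some_inj] at h
  have h1 : A s * wordProd A ((W i).take (t % (W i).length)) =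
      wordProd A ((W i).take (t % (W i).length + 1)) := by
    rw [← List.take_append_getElem hlt, wordProd_append, ← h, wordProd_cons, wordProd_nil, one_mul]
  rw [rootPt, Matrix.mulVec_smul, Matrix.mulVec_mulVec, h1, rootPt]
  congr 1
  rcases Nat.lt_or_ge (t % (W i).length + 1) (W i).length with hl | hl
  · rw [Nat.add_mod, Nat.mod_eq_of_lt (show 1 < (W i).length by omega), Nat.mod_eq_of_lt hl]
  · have he : t % (W i).length + 1 = (W i).length := by omega
    have he2 : (t + 1) % (W i).length = 0 := by
      rw [← Nat.mod_add_mod, he, Nat.mod_self]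
    rw [he, he2, List.take_length, hfix]; simp

lemma wordProd_mulVec_rootPt (hW : ∀ i, SimpleWord (W i))
    (hfix : ∀ i, wordProd A (W i) *ᵥ v i = v i) {i : Fin r} {u : List (Fin m)} {t : ℕ}
    (h : ∀ q < u.length, u[q]? = cyc (W i) (t + q)) :
    wordProd A u *ᵥ rootPt A W v α i t = rootPt A W v α i (t + u.length) := by
  induction u generalizing t with
  | nil => simp
  | cons s u ih =>
    have h0 := h 0 (by simp)
    rw [List.getElem?_cons_zero, add_zero] at h0
    rw [wordProd_cons_mulVec, mulVec_rootPt hW hfix h0, ih, List.length_cons]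
    · congr 1; omega
    · intro q hq
      have := h (q + 1) (by simpa using hq)
      rw [List.getElem?_cons_succ] at this
      rw [this]; congr 1; omega

variable {order : ℕ → Finset (Fin d → ℝ) → List (Fin d → ℝ)}

/-- The points to be tested in iteration `k + 1`. -/
noncomputable def candidates (A : Fin m → Matrix (Fin d) (Fin d) ℝ) (W : Fin r → List (Fin m))
    (v : Fin r → Fin d → ℝ) (α : Fin r → ℝ)
    (order : ℕ → Finset (Fin d → ℝ) → List (Fin d → ℝ)) : ℕ → Finset (Fin d → ℝ)
  | 0 => rootChildren A W v α
  | k + 1 => children A (state A W v α order (k + 1)).2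

lemma state_succ (k : ℕ) : state A W v α order (k + 1) =
    iteration (state A W v α order k).1 (order k (candidates A W v α order k)) := by
  cases k <;> rfl

lemma mem_children {R : Finset (Fin d → ℝ)} {x : Fin d → ℝ} :
    x ∈ children A R ↔ ∃ y ∈ R, ∃ s, x = A s *ᵥ y := by
  classical
  simp only [children, Finset.mem_image, Finset.mem_product, Finset.mem_univ, and_true]
  constructor
  · rintro ⟨p, hp, rfl⟩; exact ⟨_, hp, _, rfl⟩
  · rintro ⟨y, hy, s, rfl⟩; exact ⟨(y, s), hy, rfl⟩

lemma state_fst_subset_succ (k : ℕ) :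
    (state A W v α order k).1 ⊆ (state A W v α order (k + 1)).1 := by
  rw [state_succ]
  exact (foldl_testPoint (order k (candidates A W v α order k))
    ((state A W v α order k).1, ∅)).1

lemma state_fst_mono : Monotone fun k => (state A W v α order k).1 :=
  monotone_nat_of_le_succ state_fst_subset_succ

lemma mem_state_fst_succ {k : ℕ} {x : Fin d → ℝ} (hx : x ∈ (state A W v α order (k + 1)).1) :
    x ∈ (state A W v α order k).1 ∨ x ∈ (state A W v α order (k + 1)).2 := by
  rw [state_succ] at hx ⊢; exact (foldl_testPoint _ _).2.2.1 x hx

lemma state_snd_subset_fst (k : ℕ) :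
    (state A W v α order k).2 ⊆ (state A W v α order k).1 := by
  cases k with
  | zero => exact subset_rfl
  | succ k => rw [state_succ]; exact (foldl_testPoint _ _).2.2.2.2.2 (by simp)

lemma mem_or_mem_interior_of_mem_candidates (horder : ∀ k S x, x ∈ order k S ↔ x ∈ S) {k : ℕ}
    {x : Fin d → ℝ} (hx : x ∈ candidates A W v α order k) :
    x ∈ (state A W v α order (k + 1)).2 ∨
      x ∈ interior (absco ((state A W v α order (k + 1)).1 : Set (Fin d → ℝ))) := by
  rw [state_succ]; exact (foldl_testPoint _ _).2.2.2.1 x ((horder _ _ _).2 hx)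

lemma mem_candidates_of_mem_state_snd (horder : ∀ k S x, x ∈ order k S ↔ x ∈ S) {k : ℕ}
    {x : Fin d → ℝ} (hx : x ∈ (state A W v α order (k + 1)).2) :
    x ∈ candidates A W v α order k ∧
      x ∉ interior (absco ((state A W v α order k).1 : Set (Fin d → ℝ))) := by
  rw [state_succ] at hx
  rcases (foldl_testPoint _ _).2.2.2.2.1 x hx with h | h
  · simp at h
  · exact ⟨(horder _ _ _).1 h.1, h.2⟩

lemma interior_absco_state_mono {j k : ℕ} (h : j ≤ k) :
    interior (absco ((state A W v α order j).1 : Set (Fin d → ℝ))) ⊆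
      interior (absco ((state A W v α order k).1 : Set (Fin d → ℝ))) :=
  interior_mono (absco_mono (by exact_mod_cast state_fst_mono h))

lemma rootPt_mem_state (hW : ∀ i, SimpleWord (W i)) (k : ℕ) (i : Fin r) (t : ℕ) :
    rootPt A W v α i t ∈ (state A W v α order k).1 :=
  state_fst_mono (Nat.zero_le k) ((mem_initialSet hW).2 ⟨i, t, rfl⟩)

/-- An image of a point found up to iteration `k` is itself found, or is absorbed, in iteration
`k + 1` at the latest. -/
lemma mulVec_mem_state_succ (hW : ∀ i, SimpleWord (W i))
    (hfix : ∀ i, wordProd A (W i) *ᵥ v i = v i) (horder : ∀ k S x, x ∈ order k S ↔ x ∈ S)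
    {k : ℕ} {x : Fin d → ℝ} (hx : x ∈ (state A W v α order k).1) (s : Fin m) :
    A s *ᵥ x ∈ (state A W v α order (k + 1)).1 ∨
      A s *ᵥ x ∈ interior (absco ((state A W v α order (k + 1)).1 : Set (Fin d → ℝ))) := by
  have hcand : ∀ {k y}, y ∈ candidates A W v α order k →
      y ∈ (state A W v α order (k + 1)).1 ∨
        y ∈ interior (absco ((state A W v α order (k + 1)).1 : Set (Fin d → ℝ))) :=
    fun hy => (mem_or_mem_interior_of_mem_candidates horder hy).imp_left
      fun h => state_snd_subset_fst _ h
  induction k with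
  | zero =>
    obtain ⟨i, t, rfl⟩ := (mem_initialSet hW).1 hx
    by_cases hs : some s = cyc (W i) t
    · left
      rw [mulVec_rootPt hW hfix hs]
      exact rootPt_mem_state hW _ i _
    · exact hcand (k := 0) ((mem_rootChildren hW).2 ⟨i, t, s, hs, rfl⟩)
  | succ k ih =>
    rcases mem_state_fst_succ hx with h | h
    · exact (ih h).imp (fun h => state_fst_subset_succ _ h)
        fun h => interior_absco_state_mono (Nat.le_succ _) h
    · exact hcand (k := k + 1) (mem_children.2 ⟨x, h, s, rfl⟩)

/-- A point added in iteration `k + 1` is reached from a root vector by a word of length `k + 1`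
that leaves the cycle at once and whose intermediate points have not been absorbed. -/
lemma exists_path_of_mem_state_snd (hW : ∀ i, SimpleWord (W i))
    (horder : ∀ k S x, x ∈ order k S ↔ x ∈ S) {k : ℕ} {x : Fin d → ℝ}
    (hx : x ∈ (state A W v α order (k + 1)).2) :
    ∃ i t, ∃ u : List (Fin m), u.length = k + 1 ∧ u[0]? ≠ cyc (W i) t ∧
      x = wordProd A u *ᵥ rootPt A W v α i t ∧
      ∀ p ≤ k, wordProd A (u.take (p + 1)) *ᵥ rootPt A W v α i t ∉
        interior (absco ((state A W v α order p).1 : Set (Fin d → ℝ))) := by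
  induction k generalizing x with
  | zero =>
    obtain ⟨h1, h2⟩ := mem_candidates_of_mem_state_snd horder hx
    obtain ⟨i, t, s, hs, rfl⟩ := (mem_rootChildren hW).1 h1
    refine ⟨i, t, [s], rfl, by simpa using hs, by simp [wordProd_cons], fun p hp => ?_⟩
    obtain rfl : p = 0 := by omega
    simpa [wordProd_cons] using h2
  | succ k ih =>
    obtain ⟨h1, h2⟩ := mem_candidates_of_mem_state_snd horder hx
    obtain ⟨y, hy, s, rfl⟩ := mem_children.1 h1
    obtain ⟨i, t, u, hu, hu0, rfl, hp⟩ := ih hy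
    have he : A s *ᵥ (wordProd A u *ᵥ rootPt A W v α i t) =
        wordProd A (u ++ [s]) *ᵥ rootPt A W v α i t := by
      rw [wordProd_append_mulVec]; simp [wordProd_cons]
    refine ⟨i, t, u ++ [s], by simp [hu], ?_, he, fun p hpk => ?_⟩
    · rwa [List.getElem?_append_left (by omega)]
    · rcases Nat.lt_or_ge k p with h | h
      · obtain rfl : p = k + 1 := by omega
        rw [List.take_of_length_le (by simp [hu]), ← he]
        exact h2
      · rw [List.take_append_of_le_length (by omega)]
        exact hp p h

lemma exists_span_state_eq_top [NeZero d] (hA : IrreducibleFamily A) (hr : 1 ≤ r)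
    (hW : ∀ i, SimpleWord (W i)) (hfix : ∀ i, wordProd A (W i) *ᵥ v i = v i)
    (hv : ∀ i, v i ≠ 0) (hα : ∀ i, 0 < α i) (horder : ∀ k S x, x ∈ order k S ↔ x ∈ S) :
    ∃ K, Submodule.span ℝ ((state A W v α order K).1 : Set (Fin d → ℝ)) = ⊤ := by
  let U : ℕ →o Submodule ℝ (Fin d → ℝ) :=
    { toFun := fun k => Submodule.span ℝ ((state A W v α order k).1 : Set (Fin d → ℝ))
      monotone' := fun j k h => Submodule.span_mono (by exact_mod_cast state_fst_mono h) }
  obtain ⟨K, hK⟩ := monotone_stabilizes_iff_noetherian.2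
    (inferInstance : IsNoetherian ℝ (Fin d → ℝ)) U
  refine ⟨K, ?_⟩
  have htop : Submodule.span ℝ (⋃ k, ((state A W v α order k).1 : Set (Fin d → ℝ))) = ⊤ := by
    refine span_eq_top_of_invariant hA (x₀ := rootPt A W v α ⟨0, hr⟩ 0)
      (Set.mem_iUnion.2 ⟨0, rootPt_mem_state hW _ _ _⟩) ?_ fun x hx s => ?_
    · rw [rootPt_zero]; exact smul_ne_zero (hα _).ne' (hv _)
    · obtain ⟨k, hk⟩ := Set.mem_iUnion.1 hx
      refine (mulVec_mem_state_succ hW hfix horder hk s).imp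
        (fun h => Set.mem_iUnion.2 ⟨k + 1, h⟩) fun h => ⟨A s *ᵥ x, ?_⟩
      exact interior_mono (absco_mono (Set.subset_iUnion
        (fun k => ((state A W v α order k).1 : Set (Fin d → ℝ))) (k + 1))) h
  rw [eq_top_iff, ← htop, Submodule.span_le]
  intro x hx
  obtain ⟨k, hk⟩ := Set.mem_iUnion.1 hx
  have h1 : x ∈ U (max k K) := U.monotone (le_max_left k K) (Submodule.subset_span hk)
  rw [← hK _ (le_max_right k K)] at h1
  exact h1

end Algorithm

/-! ### Termination produces a contracted polytope -/

section Forward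

open Filter Topology
open scoped Pointwise

variable {d m r : ℕ} {A : Fin m → Matrix (Fin d) (Fin d) ℝ} {W : Fin r → List (Fin m)}
  {v : Fin r → Fin d → ℝ} {α : Fin r → ℝ}
  {order : ℕ → Finset (Fin d → ℝ) → List (Fin d → ℝ)}

/-- The symmetrized convex hull `P` of the finite set `V` is an invariant polytope of the family,
and the `N`-th powers of all products map the points of `V`, and the whole orbits of the roots, into
the smaller polytope `l P`, unless they follow the cycle of a root. -/
structure IsContractingPolytope (A : Fin m → Matrix (Fin d) (Fin d) ℝ) (W : Fin r → List (Fin m))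
    (v : Fin r → Fin d → ℝ) (α : Fin r → ℝ) (V : Set (Fin d → ℝ)) (l : ℝ) (N : ℕ) : Prop where
  finite : V.Finite
  zero_mem_interior : (0 : Fin d → ℝ) ∈ interior (absco V)
  pos : 0 < l
  lt_one : l < 1
  exponent_ne_zero : N ≠ 0
  rootPt_mem : ∀ i t, rootPt A W v α i t ∈ V
  mulVec_mem : ∀ x ∈ absco V, ∀ u, wordProd A u *ᵥ x ∈ absco V
  pow_mulVec_orbit_mem : ∀ i t u w, w ≠ [] →
    (∃ q < (W i).length * w.length, cyc w q ≠ cyc (W i) (t + u.length + q)) →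
    wordProd A w ^ N *ᵥ (wordProd A u *ᵥ rootPt A W v α i t) ∈ l • absco V
  pow_mulVec_mem : ∀ x ∈ V, (∀ i t, x ≠ rootPt A W v α i t) → ∀ w, w ≠ [] →
    wordProd A w ^ N *ᵥ x ∈ l • absco V

lemma mulVec_mem_smul_of_mem_smul {P : Set (Fin d → ℝ)} {M : Matrix (Fin d) (Fin d) ℝ}
    (h : ∀ x ∈ P, M *ᵥ x ∈ P) {l : ℝ} {x : Fin d → ℝ} (hx : x ∈ l • P) : M *ᵥ x ∈ l • P := by
  obtain ⟨y, hy, rfl⟩ := hx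
  exact ⟨M *ᵥ y, h y hy, (Matrix.mulVec_smul _ _ _).symm⟩

/-- Finitely many interior points of a set lie in a common dilate with ratio less than one. -/
lemma exists_mem_smul_of_mem_interior {P : Set (Fin d → ℝ)} (T : Finset (Fin d → ℝ)) :
    ∃ l : ℝ, 0 < l ∧ l < 1 ∧ ∀ y ∈ T, y ∈ interior P → y ∈ l • P := by
  have hev : ∀ y ∈ T, ∀ᶠ l : ℝ in 𝓝[<] 1, y ∈ interior P → l⁻¹ • y ∈ P := by
    intro y _
    by_cases hy : y ∈ interior P
    · have hc : ContinuousAt (fun l : ℝ => l⁻¹ • y) 1 :=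
        (continuousAt_inv₀ one_ne_zero).smul continuousAt_const
      have : ∀ᶠ l : ℝ in 𝓝 1, l⁻¹ • y ∈ P :=
        hc.eventually_mem (by simpa using mem_interior_iff_mem_nhds.1 hy)
      exact nhdsWithin_le_nhds (this.mono fun l h _ => h)
    · exact Eventually.of_forall fun l h => absurd h hy
  have h1 : ∀ᶠ l : ℝ in 𝓝[<] 1, l ∈ Set.Ioo (0 : ℝ) 1 := Ioo_mem_nhdsLT one_pos
  obtain ⟨l, hl, hT⟩ := (h1.and ((Finset.eventually_all T).2 hev)).exists
  exact ⟨l, hl.1, hl.2, fun y hy hi =>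
    (Set.mem_smul_set_iff_inv_smul_mem₀ hl.1.ne' _ _).2 (hT y hy hi)⟩

/-- A state in which nothing more is added yields a contracting polytope. A word that has left the
cycle of a root passes, within the number of iterations performed, through an absorbed point. -/
lemma exists_isContractingPolytope [NeZero d] (hA : IrreducibleFamily A) (hr : 1 ≤ r)
    (hW : ∀ i, SimpleWord (W i)) (hfix : ∀ i, wordProd A (W i) *ᵥ v i = v i)
    (hv : ∀ i, v i ≠ 0) (hα : ∀ i, 0 < α i) (horder : ∀ k S x, x ∈ order k S ↔ x ∈ S)
    (hterm : Terminates A W v α order) :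
    ∃ V l N, IsContractingPolytope A W v α V l N := by
  classical
  obtain ⟨k, hk, hempty⟩ := hterm
  set V := (state A W v α order k).1 with hVdef
  set P := absco (V : Set (Fin d → ℝ)) with hPdef
  have hstep : ∀ x ∈ V, ∀ s, A s *ᵥ x ∈ V ∨ A s *ᵥ x ∈ interior P := by
    obtain ⟨j, rfl⟩ : ∃ j, k = j + 1 := ⟨k - 1, by omega⟩
    intro x hx s
    refine mulVec_mem_state_succ hW hfix horder ((mem_state_fst_succ hx).resolve_right ?_) s
    simp [hempty]
  have hroot : ∀ i t, rootPt A W v α i t ∈ V := rootPt_mem_state hW k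
  have h0 : (0 : Fin d → ℝ) ∈ interior P := by
    refine zero_mem_interior_absco (span_eq_top_of_invariant hA (x₀ := rootPt A W v α ⟨0, hr⟩ 0)
      (hroot _ _) ?_ fun x hx s => (hstep x hx s).imp_right fun h => ⟨_, h⟩)
    rw [rootPt_zero]; exact smul_ne_zero (hα _).ne' (hv _)
  have hPs : ∀ s, ∀ x ∈ P, A s *ᵥ x ∈ P := fun s x hx =>
    mulVec_mem_of_mem_absco _ (convex_absco _) (fun _ => neg_mem_absco)
      (fun y hy => (hstep y hy s).elim (fun h => subset_absco _ h) fun h => interior_subset h) hx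
  have hPu : ∀ u, ∀ x ∈ P, wordProd A u *ᵥ x ∈ P := by
    intro u
    induction u with
    | nil => simp
    | cons s u ih => intro x hx; rw [wordProd_cons_mulVec]; exact ih _ (hPs s x hx)
  obtain ⟨l, hl0, hl1, hlT⟩ := exists_mem_smul_of_mem_interior (P := P) (children A V)
  have habs : ∀ x ∈ V, ∀ s, A s *ᵥ x ∈ interior P → ∀ u, wordProd A u *ᵥ (A s *ᵥ x) ∈ l • P :=
    fun x hx s hi u => mulVec_mem_smul_of_mem_smul (hPu u)
      (hlT _ (mem_children.2 ⟨x, hx, s, rfl⟩) hi)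
  -- points added in iteration `j` survive for at most `k - j` further steps
  have hgen : ∀ u j x, 1 ≤ j → j ≤ k → x ∈ (state A W v α order j).2 → k ≤ u.length + j →
      wordProd A u *ᵥ x ∈ l • P := by
    intro u
    induction u with
    | nil =>
      intro j x h1 hj hx hlen
      obtain rfl : j = k := by simp at hlen; omega
      simp [hempty] at hx
    | cons s u ih =>
      intro j x h1 hj hx hlen
      have hjk : j ≠ k := by rintro rfl; simp [hempty] at hx
      have hxV : x ∈ V := state_fst_mono hj (state_snd_subset_fst _ hx)
      rw [wordProd_cons_mulVec]
      obtain ⟨j, rfl⟩ : ∃ i, j = i + 1 := ⟨j - 1, by omega⟩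
      have hc : A s *ᵥ x ∈ candidates A W v α order (j + 1) := mem_children.2 ⟨x, hx, s, rfl⟩
      rcases mem_or_mem_interior_of_mem_candidates horder hc with h | h
      · exact ih _ _ (by omega) (by omega) h (by simp at hlen; omega)
      · exact habs x hxV s (interior_absco_state_mono (by omega) h) u
  have hleave : ∀ b a i t, k ≤ b.length → (∃ q < a.length, a[q]? ≠ cyc (W i) (t + q)) →
      wordProd A (a ++ b) *ᵥ rootPt A W v α i t ∈ l • P := by
    intro b a
    induction a with
    | nil => rintro i t - ⟨q, hq, -⟩; simp at hq
    | cons s a ih =>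
      rintro i t hb ⟨q, hq, hne⟩
      rw [List.cons_append, wordProd_cons_mulVec]
      by_cases hs : some s = cyc (W i) t
      · rw [mulVec_rootPt hW hfix hs]
        refine ih i (t + 1) hb ?_
        rcases q with _ | q
        · exact absurd (by simpa using hs) hne
        · refine ⟨q, by simpa using hq, ?_⟩
          rwa [List.getElem?_cons_succ, ← add_assoc, add_right_comm] at hne
      · have hc : A s *ᵥ rootPt A W v α i t ∈ candidates A W v α order 0 :=
          (mem_rootChildren hW).2 ⟨i, t, s, hs, rfl⟩
        rcases mem_or_mem_interior_of_mem_candidates horder hc with h | h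
        · exact hgen _ 1 _ le_rfl hk h (by simp; omega)
        · exact habs _ (hroot i t) s (interior_absco_state_mono hk h) _
  have hmem : ∀ j ≤ k, ∀ x ∈ (state A W v α order j).1, (∃ i t, x = rootPt A W v α i t) ∨
      ∃ j', 1 ≤ j' ∧ j' ≤ k ∧ x ∈ (state A W v α order j').2 := by
    intro j
    induction j with
    | zero => intro _ x hx; exact Or.inl ((mem_initialSet hW).1 hx)
    | succ j ih =>
      intro hj x hx
      rcases mem_state_fst_succ hx with h | h
      · exact ih (by omega) x h
      · exact Or.inr ⟨j + 1, by omega, hj, h⟩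
  obtain ⟨N, hkN, hN⟩ : ∃ N, k ≤ N ∧ ∀ i, k + (W i).length ≤ N :=
    ⟨k + ∑ i, (W i).length, Nat.le_add_right _ _, fun i => Nat.add_le_add_left
      (Finset.single_le_sum (f := fun i => (W i).length) (fun _ _ => Nat.zero_le _)
        (Finset.mem_univ i)) k⟩
  have hlen : ∀ (n : ℕ) (w : List (Fin m)), w ≠ [] →
      n ≤ (List.replicate n w).flatten.length := by
    intro n w hw
    have : 1 ≤ w.length := List.length_pos_iff.2 hw
    simp only [List.length_flatten, List.map_replicate, List.sum_replicate, smul_eq_mul]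
    nlinarith
  refine ⟨V, l, N, V.finite_toSet, h0, hl0, hl1, by omega, hroot, fun x hx u => hPu u x hx,
    ?_, ?_⟩
  · rintro i t u w hw ⟨q, hq, hne⟩
    rw [← wordProd_flatten_replicate, ← wordProd_append_mulVec]
    by_cases hu : ∃ q < u.length, u[q]? ≠ cyc (W i) (t + q)
    · exact hleave _ _ _ _ (hkN.trans (hlen N w hw)) hu
    · push Not at hu
      rw [wordProd_append_mulVec, wordProd_mulVec_rootPt hW hfix hu]
      have hNi := hN i
      rw [show N = (W i).length + (N - (W i).length) by omega, List.replicate_add,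
        List.flatten_append]
      refine hleave _ _ _ _ (le_trans (by omega) (hlen _ w hw)) ⟨q, by simpa using hq, ?_⟩
      rwa [getElem?_flatten_replicate _ _ hq]
  · intro x hx hnot w hw
    rcases hmem k le_rfl x hx with ⟨i, t, h⟩ | ⟨j, hj1, hjk, hj⟩
    · exact absurd h (hnot i t)
    · rw [← wordProd_flatten_replicate]
      exact hgen _ j x hj1 hjk hj ((hkN.trans (hlen N w hw)).trans (Nat.le_add_right _ _))

namespace IsContractingPolytope

variable {V : Set (Fin d → ℝ)} {l : ℝ} {N : ℕ}

lemma exists_norm_le (h : IsContractingPolytope A W v α V l N) :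
    ∃ B, 0 ≤ B ∧ ∀ p ∈ absco V, ‖p‖ ≤ B := by
  obtain ⟨B, hB⟩ := (isCompact_absco h.finite).isBounded.exists_norm_le
  exact ⟨|B|, abs_nonneg B, fun p hp => (hB p hp).trans (le_abs_self B)⟩

/-- The polytope is absorbing. -/
lemma exists_smul_eq (h : IsContractingPolytope A W v α V l N) (x : Fin d → ℝ) :
    ∃ c : ℝ, ∃ p ∈ absco V, x = c • p := by
  have hc : Tendsto (fun e : ℝ => e • x) (𝓝[>] 0) (𝓝 0) := by
    have : Continuous fun e : ℝ => e • x := by fun_prop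
    simpa using (this.tendsto 0).mono_left nhdsWithin_le_nhds
  obtain ⟨e, he, he0⟩ := ((hc.eventually_mem (mem_interior_iff_mem_nhds.1
    h.zero_mem_interior)).and self_mem_nhdsWithin).exists
  exact ⟨e⁻¹, e • x, he, by rw [smul_smul, inv_mul_cancel₀ (ne_of_gt he0), one_smul]⟩

lemma neg_mem_smul {x : Fin d → ℝ} (hx : x ∈ l • absco V) : -x ∈ l • absco V := by
  obtain ⟨y, hy, rfl⟩ := hx
  exact ⟨-y, neg_mem_absco hy, smul_neg _ _⟩

/-- Products that follow no cycle contract the polytope, uniformly over all of them. -/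
lemma exists_specRad_lt [NeZero d] (h : IsContractingPolytope A W v α V l N)
    (hW : ∀ i, SimpleWord (W i)) :
    ∃ γ : ℝ, γ < 1 ∧ ∀ w : List (Fin m), w ≠ [] →
      (¬ ∃ i, ∃ u, u.IsRotated (W i) ∧ IsPowerOf w u) → specRad (wordProd A w) < γ := by
  obtain ⟨g, hg0, hg1, hgl⟩ : ∃ g : ℝ, 0 < g ∧ g < 1 ∧ l < g ^ N := by
    have hc : ContinuousAt (fun g : ℝ => g ^ N) 1 := (continuous_pow N).continuousAt
    have h1 : ∀ᶠ g : ℝ in 𝓝[<] 1, l < g ^ N :=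
      nhdsWithin_le_nhds (hc.eventually_const_lt (by simpa using h.lt_one))
    have h2 : ∀ᶠ g : ℝ in 𝓝[<] 1, g ∈ Set.Ioo (0 : ℝ) 1 := Ioo_mem_nhdsLT one_pos
    obtain ⟨g, hg, hg'⟩ := (h1.and h2).exists
    exact ⟨g, hg'.1, hg'.2, hg⟩
  refine ⟨g, hg1, fun w hw hnot => ?_⟩
  have hdev : ∀ i t, ∃ q < (W i).length * w.length, cyc w q ≠ cyc (W i) (t + q) := by
    intro i t
    by_contra! hall
    exact hnot ⟨i, _, List.IsRotated.symm ⟨t, rfl⟩, (hW i).isPowerOf_of_agree hw hall⟩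
  have hV : ∀ x ∈ V, wordProd A w ^ N *ᵥ x ∈ l • absco V := by
    intro x hx
    by_cases hx' : ∃ i t, x = rootPt A W v α i t
    · obtain ⟨i, t, rfl⟩ := hx'
      simpa using h.pow_mulVec_orbit_mem i t [] w hw (by simpa using hdev i t)
    · push Not at hx'
      exact h.pow_mulVec_mem x hx hx' w hw
  have hP : ∀ x ∈ absco V, wordProd A w ^ N *ᵥ x ∈ l • absco V := fun x hx =>
    mulVec_mem_of_mem_absco _ ((convex_absco V).smul l) (fun _ => neg_mem_smul) hV hx
  have hpow : ∀ k : ℕ, ∀ x ∈ absco V, wordProd A w ^ (N * k) *ᵥ x ∈ l ^ k • absco V := by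
    intro k
    induction k with
    | zero => simp
    | succ k ih =>
      intro x hx
      rw [Nat.mul_succ, pow_add _ (N * k) N, ← Matrix.mulVec_mulVec]
      obtain ⟨y, hy, hxy⟩ := hP x hx
      obtain ⟨z, hz, hyz⟩ := ih y hy
      refine ⟨z, hz, ?_⟩
      simp only at hxy hyz ⊢
      rw [← hxy, Matrix.mulVec_smul, ← hyz, smul_smul, pow_succ, mul_comm]
  obtain ⟨B, hB0, hB⟩ := h.exists_norm_le
  have hle : specRad (wordProd A w) ^ N ≤ l := by
    refine specRad_pow_le h.pos fun x => ?_
    obtain ⟨c, p, hp, rfl⟩ := h.exists_smul_eq x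
    refine ⟨|c| * B, fun k => ?_⟩
    obtain ⟨y, hy, hxy⟩ := hpow k p hp
    simp only at hxy
    rw [Matrix.mulVec_smul, ← hxy, norm_smul, norm_smul, Real.norm_eq_abs, Real.norm_eq_abs,
      abs_of_pos (pow_pos h.pos k)]
    calc |c| * (l ^ k * ‖y‖) ≤ |c| * (l ^ k * B) := by
          have := hB y hy
          have := pow_pos h.pos k
          gcongr
      _ = |c| * B * l ^ k := by ring
  exact lt_of_pow_lt_pow_left₀ N hg0.le (hle.trans_lt hgl)

/-- By simplicity and inequivalence of the words, the cycle of the `j`-th root starting at `v j` is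
the only one that the powers of `W j` follow. -/
lemma pow_mulVec_mem_of_ne (h : IsContractingPolytope A W v α V l N)
    (hW : ∀ i, SimpleWord (W i)) (hdiff : ∀ i j, i ≠ j → ¬ (W i).IsRotated (W j)) (j : Fin r)
    {x : Fin d → ℝ} (hx : x ∈ V) (hne : x ≠ α j • v j) :
    wordProd A (W j) ^ N *ᵥ x ∈ l • absco V := by
  by_cases hx' : ∃ i t, x = rootPt A W v α i t
  · obtain ⟨i, t, rfl⟩ := hx'
    have := h.pow_mulVec_orbit_mem i t [] (W j) (hW j).1
    rw [wordProd_nil, Matrix.one_mulVec] at this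
    refine this ?_
    by_contra! hall
    simp only [List.length_nil, add_zero] at hall
    have hrot := (hW i).eq_rotate_of_agree (hW j) hall
    by_cases hij : i = j
    · subst hij
      obtain ⟨c, hc⟩ := (hW i).length_dvd_of_rotate_eq hrot.symm
      apply hne
      rw [← rootPt_mod, hc, Nat.mul_mod_right, rootPt_zero]
    · exact hdiff i j hij ⟨t, hrot.symm⟩
  · push Not at hx'
    exact h.pow_mulVec_mem x hx hx' _ (hW j).1

lemma exists_adjoint [NeZero d] (h : IsContractingPolytope A W v α V l N)
    (hfix : ∀ i, wordProd A (W i) *ᵥ v i = v i) (hv : ∀ i, v i ≠ 0) (j : Fin r) :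
    ∃ f, (wordProd A (W j))ᵀ *ᵥ f = f ∧ f ⬝ᵥ v j = 1 := by
  refine exists_adjoint_fixed (hfix j) (hv j) fun x => ?_
  obtain ⟨B, hB0, hB⟩ := h.exists_norm_le
  obtain ⟨c, p, hp, rfl⟩ := h.exists_smul_eq x
  refine ⟨|c| * B, fun k => ?_⟩
  rw [Matrix.mulVec_smul, norm_smul, ← wordProd_flatten_replicate, Real.norm_eq_abs]
  exact mul_le_mul_of_nonneg_left (hB _ (h.mulVec_mem p hp _)) (abs_nonneg c)

/-- Modulo the leading eigenvector, the `N`-th power of a leading product contracts the polytope.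
Hence its powers converge to a rank one projection. -/
lemma uniqueSimpleLeadingEigenvalue [NeZero d] (h : IsContractingPolytope A W v α V l N)
    (hW : ∀ i, SimpleWord (W i)) (hdiff : ∀ i j, i ≠ j → ¬ (W i).IsRotated (W j))
    (hfix : ∀ i, wordProd A (W i) *ᵥ v i = v i) (hv : ∀ i, v i ≠ 0) (j : Fin r)
    (hρ : specRad (wordProd A (W j)) = 1) :
    UniqueSimpleLeadingEigenvalue (wordProd A (W j)) := by
  obtain ⟨f, hf, hfv⟩ := h.exists_adjoint hfix hv j
  set M := wordProd A (W j) with hM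
  have hP : ∀ x ∈ absco V,
      M ^ N *ᵥ x ∈ l • absco V + (Submodule.span ℝ {v j} : Set (Fin d → ℝ)) := by
    intro x hx
    refine mulVec_mem_of_mem_absco _ (((convex_absco V).smul l).add (Submodule.convex _)) ?_ ?_ hx
    · rintro _ ⟨y, hy, z, hz, rfl⟩
      exact ⟨-y, neg_mem_smul hy, -z, neg_mem hz, (neg_add y z).symm⟩
    · intro y hy
      by_cases hne : y = α j • v j
      · refine ⟨0, ⟨0, interior_subset h.zero_mem_interior, smul_zero _⟩, α j • v j,
          Submodule.smul_mem _ _ (Submodule.mem_span_singleton_self _), ?_⟩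
        simp only [zero_add]
        rw [hne, Matrix.mulVec_smul, pow_mulVec_of_fixed (hfix j)]
      · exact ⟨_, h.pow_mulVec_mem_of_ne hW hdiff j hy hne, 0, zero_mem _, add_zero _⟩
  have hpow : ∀ k : ℕ, ∀ x ∈ absco V, ∃ p ∈ absco V, ∃ c : ℝ,
      M ^ (N * k) *ᵥ x = l ^ k • p + c • v j := by
    intro k
    induction k with
    | zero => intro x hx; exact ⟨x, hx, 0, by simp⟩
    | succ k ih =>
      intro x hx
      obtain ⟨_, ⟨y, hy, rfl⟩, z, hz, hxyz⟩ := hP x hx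
      obtain ⟨c, rfl⟩ := Submodule.mem_span_singleton.1 hz
      obtain ⟨p, hp, c', hc'⟩ := ih y hy
      refine ⟨p, hp, l * c' + c, ?_⟩
      simp only at hxyz
      rw [Nat.mul_succ, pow_add, ← Matrix.mulVec_mulVec, ← hxyz, Matrix.mulVec_add,
        Matrix.mulVec_smul, Matrix.mulVec_smul, hc', pow_mulVec_of_fixed (hfix j)]
      module
  obtain ⟨B, hB⟩ := ((isCompact_absco h.finite).image
    (f := fun p => ‖p - (f ⬝ᵥ p) • v j‖) (by fun_prop)).bddAbove
  refine uniqueSimpleLeadingEigenvalue_of_tendsto (N := N) hρ (hfix j) hf hfv fun x => ?_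
  obtain ⟨c, p, hp, rfl⟩ := h.exists_smul_eq x
  rw [tendsto_iff_norm_sub_tendsto_zero]
  have hlim : Tendsto (fun k : ℕ => |c| * (l ^ k * B)) atTop (𝓝 0) := by
    simpa using
      ((tendsto_pow_atTop_nhds_zero_of_lt_one h.pos.le h.lt_one).mul_const B).const_mul |c|
  refine squeeze_zero (fun _ => norm_nonneg _) (fun k => ?_) hlim
  obtain ⟨y, hy, c', hc'⟩ := hpow k p hp
  have hfp : f ⬝ᵥ p = l ^ k * (f ⬝ᵥ y) + c' := by
    rw [← dotProduct_pow_mulVec_of_adjoint hf (N * k) p, hc', dotProduct_add, dotProduct_smul,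
      dotProduct_smul, hfv]
    simp
  have he : M ^ (N * k) *ᵥ (c • p) - (f ⬝ᵥ c • p) • v j =
      c • (l ^ k • (y - (f ⬝ᵥ y) • v j)) := by
    rw [Matrix.mulVec_smul, hc', dotProduct_smul, hfp, smul_eq_mul]
    module
  rw [he, norm_smul, norm_smul, Real.norm_eq_abs, Real.norm_eq_abs, abs_of_pos (pow_pos h.pos k)]
  have := hB ⟨y, hy, rfl⟩
  have := pow_pos h.pos k
  gcongr

/-- On the polytope the adjoint leading eigenvector `f` of the `j`-th product is at most `α j`:
every vertex other than `α j • v j` is contracted by a power of the product, which preserves `f`. -/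
lemma abs_dotProduct_le [NeZero d] (h : IsContractingPolytope A W v α V l N)
    (hW : ∀ i, SimpleWord (W i)) (hdiff : ∀ i j, i ≠ j → ¬ (W i).IsRotated (W j))
    (hα : ∀ i, 0 < α i) {j : Fin r} {f : Fin d → ℝ} (hf : (wordProd A (W j))ᵀ *ᵥ f = f)
    (hfv : f ⬝ᵥ v j = 1) {x : Fin d → ℝ} (hx : x ∈ absco V) : |f ⬝ᵥ x| ≤ α j := by
  obtain ⟨y, hy, hmax⟩ := (isCompact_absco h.finite).exists_isMaxOn
    ⟨0, interior_subset h.zero_mem_interior⟩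
    (f := fun p => |f ⬝ᵥ p|) (by fun_prop)
  have hb : ∀ z ∈ absco V, |f ⬝ᵥ z| ≤ max (α j) (l * |f ⬝ᵥ y|) := by
    intro z hz
    have hsub : absco V ⊆ {z | |f ⬝ᵥ z| ≤ max (α j) (l * |f ⬝ᵥ y|)} := by
      have hV : ∀ z ∈ V, |f ⬝ᵥ z| ≤ max (α j) (l * |f ⬝ᵥ y|) := by
        intro z hz
        by_cases hne : z = α j • v j
        · rw [hne, dotProduct_smul, hfv, smul_eq_mul, mul_one, abs_of_pos (hα j)]
          exact le_max_left _ _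
        · obtain ⟨p, hp, hpz⟩ := h.pow_mulVec_mem_of_ne hW hdiff j hz hne
          simp only at hpz
          rw [← dotProduct_pow_mulVec_of_adjoint hf N z, ← hpz, dotProduct_smul, smul_eq_mul,
            abs_mul, abs_of_pos h.pos]
          exact (mul_le_mul_of_nonneg_left (hmax hp) h.pos.le).trans (le_max_right _ _)
      refine convexHull_min ?_ ?_
      · rintro z (hz | ⟨z, hz, rfl⟩)
        · exact hV z hz
        · simpa using hV z hz
      · intro a ha b hb s t hs ht hst
        simp only [Set.mem_ofPred_eq] at ha hb ⊢
        rw [dotProduct_add, dotProduct_smul, dotProduct_smul, smul_eq_mul, smul_eq_mul]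
        refine (abs_add_le _ _).trans ?_
        rw [abs_mul, abs_mul, abs_of_nonneg hs, abs_of_nonneg ht]
        calc _ ≤ s * max (α j) (l * |f ⬝ᵥ y|) + t * max (α j) (l * |f ⬝ᵥ y|) := by gcongr
          _ = _ := by rw [← add_mul, hst, one_mul]
    exact hsub hz
  have hym := hb y hy
  have hle : |f ⬝ᵥ y| ≤ α j := by
    rcases le_max_iff.1 hym with h1 | h1
    · exact h1
    · have := h.lt_one
      have := hα j
      nlinarith [abs_nonneg (f ⬝ᵥ y)]
  exact (hmax hx).trans hle

lemma admissible [NeZero d] (h : IsContractingPolytope A W v α V l N)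
    (hW : ∀ i, SimpleWord (W i)) (hdiff : ∀ i j, i ≠ j → ¬ (W i).IsRotated (W j))
    (hfix : ∀ i, wordProd A (W i) *ᵥ v i = v i) (hv : ∀ i, v i ≠ 0) (hα : ∀ i, 0 < α i) :
    Admissible A W v α := by
  choose f hf using h.exists_adjoint hfix hv
  refine ⟨f, hf, fun i j hij => ?_⟩
  have hq : q A (W i) (v i) (f j) ≤ ENNReal.ofReal (l * α j / α i) := by
    refine iSup₂_le fun t u => ENNReal.ofReal_le_ofReal ?_
    have hmem : wordProd A (W j) ^ N *ᵥ (wordProd A u *ᵥ rootPt A W v α i t) ∈ l • absco V := by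
      refine h.pow_mulVec_orbit_mem i t u (W j) (hW j).1 ?_
      by_contra! hall
      exact hdiff i j hij ⟨_, ((hW i).eq_rotate_of_agree (hW j) hall).symm⟩
    obtain ⟨p, hp, hpe⟩ := hmem
    simp only at hpe
    have h1 : f j ⬝ᵥ (wordProd A u *ᵥ rootPt A W v α i t) = l * (f j ⬝ᵥ p) := by
      rw [← dotProduct_pow_mulVec_of_adjoint (hf j).1 N, ← hpe, dotProduct_smul, smul_eq_mul]
    rw [rootPt_eq_smul_rootVec, Matrix.mulVec_smul, dotProduct_smul, smul_eq_mul] at h1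
    rw [le_div_iff₀ (hα i), mul_comm, ← abs_of_pos (hα i), ← abs_mul, h1, abs_mul,
      abs_of_pos h.pos]
    exact mul_le_mul_of_nonneg_left
      (h.abs_dotProduct_le hW hdiff hα (hf j).1 (hf j).2 hp) h.pos.le
  calc ENNReal.ofReal (α i) * q A (W i) (v i) (f j)
      ≤ ENNReal.ofReal (α i) * ENNReal.ofReal (l * α j / α i) := by gcongr
    _ = ENNReal.ofReal (l * α j) := by
        rw [← ENNReal.ofReal_mul (hα i).le]
        congr 1
        field_simp [(hα i).ne']
    _ < ENNReal.ofReal (α j) := by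
        rw [ENNReal.ofReal_lt_ofReal_iff (hα j)]
        have := h.lt_one
        have := hα j
        nlinarith

end IsContractingPolytope

end Forward

/-! ### Dominance and admissibility force termination -/

section Backward

open Filter Topology

variable {d m r : ℕ} {A : Fin m → Matrix (Fin d) (Fin d) ℝ} {W : Fin r → List (Fin m)}
  {v : Fin r → Fin d → ℝ} {α : Fin r → ℝ}
  {order : ℕ → Finset (Fin d → ℝ) → List (Fin d → ℝ)}

lemma mul_pow_mul_comm {R : Type*} [Monoid R] (X Y : R) (k : ℕ) :
    (X * Y) ^ k * X = X * (Y * X) ^ k := by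
  induction k with
  | zero => simp
  | succ k ih => rw [pow_succ', mul_assoc, ih, pow_succ', ← mul_assoc, ← mul_assoc, mul_assoc X]

lemma trace_mul_pow_comm (X Y : Matrix (Fin d) (Fin d) ℝ) (k : ℕ) :
    ((X * Y) ^ k).trace = ((Y * X) ^ k).trace := by
  cases k with
  | zero => simp
  | succ k => rw [pow_succ, ← mul_assoc, mul_pow_mul_comm, mul_assoc, Matrix.trace_mul_comm,
      mul_assoc, ← pow_succ]

lemma trace_wordProd_pow_of_isRotated {u w : List (Fin m)} (h : u.IsRotated w) (k : ℕ) :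
    (wordProd A u ^ k).trace = (wordProd A w ^ k).trace := by
  obtain ⟨n, hn, rfl⟩ := List.isRotated_iff_mod.1 h
  rw [List.rotate_eq_drop_append_take hn, wordProd_append, trace_mul_pow_comm, ← wordProd_append,
    List.take_append_drop]

/-- Dominance bounds the traces of all products, hence the semigroup they form. -/
lemma exists_bound_of_dominant [NeZero d] (hA : IrreducibleFamily A)
    (hfix : ∀ i, wordProd A (W i) *ᵥ v i = v i)
    (hρ : ∀ i, specRad (wordProd A (W i)) = 1)
    (hs : ∀ i, UniqueSimpleLeadingEigenvalue (wordProd A (W i)))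
    {f : Fin r → Fin d → ℝ} (hf : ∀ j, (wordProd A (W j))ᵀ *ᵥ f j = f j ∧ f j ⬝ᵥ v j = 1)
    {γ : ℝ} (hγ : γ < 1) (hdom : ∀ w : List (Fin m), w ≠ [] →
      (¬ ∃ i, ∃ u, u.IsRotated (W i) ∧ IsPowerOf w u) → specRad (wordProd A w) < γ) :
    ∃ C, 0 < C ∧ ∀ w x, ‖wordProd A w *ᵥ x‖ ≤ C * ‖x‖ := by
  have hpow : ∀ i k, specRad (wordProd A (W i) ^ k) ≤ 1 := by
    intro i k
    have := specRad_pow_le (M := wordProd A (W i) ^ k) (N := 1) one_pos fun x => ?_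
    · simpa using this
    have hlim : Tendsto (fun n : ℕ => wordProd A (W i) ^ n *ᵥ x) atTop
        (𝓝 ((f i ⬝ᵥ x) • v i)) := by
      rw [Metric.tendsto_atTop]
      intro ε hε
      obtain ⟨N, hN⟩ := exists_pow_mulVec_sub_le (hs i) (hρ i) (hfix i) (hf i).1 (hf i).2
        (ε := ε / (‖x‖ + 1)) (by positivity)
      refine ⟨N, fun n hn => ?_⟩
      rw [dist_eq_norm]
      refine (hN n hn x).trans_lt ?_
      rw [div_mul_eq_mul_div, div_lt_iff₀ (by positivity)]
      nlinarith [norm_nonneg x]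
    obtain ⟨C, hC⟩ := hlim.norm.bddAbove_range
    refine ⟨C, fun n => ?_⟩
    rw [← pow_mul, one_mul, one_pow, mul_one]
    exact hC ⟨k * n, rfl⟩
  refine exists_bound_of_trace_bound hA (C₀ := d) fun w => ?_
  have key : ∀ M : Matrix (Fin d) (Fin d) ℝ, specRad M ≤ 1 → |M.trace| ≤ d := fun M hM =>
    (abs_trace_le M).trans (mul_le_of_le_one_right (Nat.cast_nonneg d) hM)
  by_cases hw : w = []
  · rw [hw, wordProd_nil]; simp
  · by_cases hex : ∃ i, ∃ u, u.IsRotated (W i) ∧ IsPowerOf w u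
    · obtain ⟨i, u, hu, k, -, rfl⟩ := hex
      rw [wordProd_flatten_replicate, trace_wordProd_pow_of_isRotated hu]
      exact key _ (hpow i k)
    · exact key _ ((hdom w hw hex).le.trans hγ.le)

/-- If a word consisting of `u`, many copies of `W i` and the first `l` letters of `W i` runs along
the cycle of some root, then this is the `i`-th root and `u` starts at its `l`-th letter. -/
lemma getElem?_zero_eq_of_isPowerOf (hW : ∀ i, SimpleWord (W i))
    (hdiff : ∀ i j, i ≠ j → ¬ (W i).IsRotated (W j)) {i j : Fin r} {u u' : List (Fin m)}
    {N l : ℕ} (hu : u ≠ []) (hl : l < (W i).length) (hN : (W j).length ≤ N)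
    (hrot : u'.IsRotated (W j))
    (hpow : IsPowerOf (u ++ (List.replicate N (W i)).flatten ++ (W i).take l) u') :
    u[0]? = cyc (W i) l := by
  obtain ⟨hdvd, o, ho⟩ := exists_agree_of_isPowerOf_rotated hrot hpow
  have hlen : (u ++ (List.replicate N (W i)).flatten ++ (W i).take l).length =
      u.length + N * (W i).length + l := by simp [hl.le, add_assoc]
  rw [hlen] at ho hdvd
  have hflat : (List.replicate N (W i)).flatten.length = N * (W i).length := by simp
  have hagree : ∀ q < (W j).length * (W i).length,
      cyc (W i) q = cyc (W j) (o + u.length + q) := by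
    intro q hq
    have hq' : q < N * (W i).length := hq.trans_le (Nat.mul_le_mul_right _ hN)
    have h1 := ho (u.length + q) (by omega)
    rw [List.append_assoc, List.getElem?_append_right (by omega), Nat.add_sub_cancel_left,
      List.getElem?_append_left (by omega), getElem?_flatten_replicate _ _ hq'] at h1
    rw [h1, add_assoc]
  have hji := (hW j).eq_rotate_of_agree (hW i) hagree
  obtain rfl : j = i := by
    by_contra hne
    exact hdiff j i hne ⟨_, hji.symm⟩
  have h2 : (W j).length ∣ o + u.length := (hW j).length_dvd_of_rotate_eq hji.symm
  have h3 : (W j).length ∣ l + u.length := by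
    have : u.length + N * (W j).length + l = (l + u.length) + N * (W j).length := by ring
    rw [this] at hdvd
    exact (Nat.dvd_add_left (Dvd.intro_left _ rfl)).1 hdvd
  have h4 : o ≡ l [MOD (W j).length] :=
    Nat.ModEq.add_right_cancel' u.length
      (((Nat.modEq_zero_iff_dvd).2 h2).trans ((Nat.modEq_zero_iff_dvd).2 h3).symm)
  have hu0 : 0 < u.length := List.length_pos_iff.2 hu
  have h5 := ho 0 (by omega)
  rw [List.append_assoc, List.getElem?_append_left hu0, add_zero] at h5
  rw [h5, cyc_eq_of_modEq h4]

/-- An orbit that leaves the cycle of the `i`-th root at once has a component along `v i` that is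
uniformly smaller than that of the root. Otherwise the orbit could be closed up, by many turns of
the cycle, to an almost fixed vector, and the closing word would have to follow a cycle. -/
lemma abs_dotProduct_orbit_le_of_leaves [NeZero d] (hW : ∀ i, SimpleWord (W i))
    (hdiff : ∀ i j, i ≠ j → ¬ (W i).IsRotated (W j))
    (hfix : ∀ i, wordProd A (W i) *ᵥ v i = v i) (hv : ∀ i, v i ≠ 0) (hα : ∀ i, 0 < α i)
    (hρ : ∀ i, specRad (wordProd A (W i)) = 1)
    (hs : ∀ i, UniqueSimpleLeadingEigenvalue (wordProd A (W i)))
    {f : Fin r → Fin d → ℝ} (hf : ∀ j, (wordProd A (W j))ᵀ *ᵥ f j = f j ∧ f j ⬝ᵥ v j = 1)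
    {γ : ℝ} (hγ : γ < 1) (hdom : ∀ w : List (Fin m), w ≠ [] →
      (¬ ∃ i, ∃ u, u.IsRotated (W i) ∧ IsPowerOf w u) → specRad (wordProd A w) < γ)
    {C : ℝ} (hC : 0 < C) (hbd : ∀ w x, ‖wordProd A w *ᵥ x‖ ≤ C * ‖x‖) (i : Fin r) (t : ℕ)
    (u : List (Fin m)) (hu : u ≠ []) (hleave : u[0]? ≠ cyc (W i) t) :
    |f i ⬝ᵥ (wordProd A u *ᵥ rootPt A W v α i t)| ≤ (1 + γ) / 2 * α i := by
  set l := t % (W i).length with hl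
  have hlt : l < (W i).length := Nat.mod_lt _ (hW i).length_pos
  set y := wordProd A ((W i).take l) *ᵥ v i with hy
  have hroot : rootPt A W v α i t = α i • y := rfl
  rw [hroot, Matrix.mulVec_smul, dotProduct_smul, smul_eq_mul, abs_mul, abs_of_pos (hα i),
    mul_comm]
  refine mul_le_mul_of_nonneg_right ?_ (hα i).le
  set z := wordProd A u *ᵥ y with hz
  by_contra! hlarge
  have hy0 : 0 < ‖y‖ := by
    rw [norm_pos_iff]
    intro h0
    have h1 : wordProd A ((W i).drop l) *ᵥ y = v i := by
      rw [hy, ← wordProd_append_mulVec, List.take_append_drop, hfix]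
    rw [h0, Matrix.mulVec_zero] at h1
    exact hv i h1.symm
  obtain ⟨κ, hκ, happ⟩ := exists_approx_eigen_bound (d := d) C |f i ⬝ᵥ z| γ ((1 + γ) / 2)
    (by linarith)
  obtain ⟨N₁, hN₁⟩ := exists_pow_mulVec_sub_le (hs i) (hρ i) (hfix i) (hf i).1 (hf i).2
    (ε := κ / (2 * C ^ 2)) (by positivity)
  obtain ⟨N, hNN, hN⟩ : ∃ N, N₁ ≤ N ∧ ∀ j, (W j).length ≤ N :=
    ⟨N₁ + ∑ j, (W j).length, Nat.le_add_right _ _, fun j =>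
      (Finset.single_le_sum (f := fun j => (W j).length) (fun _ _ => Nat.zero_le _)
        (Finset.mem_univ j)).trans (Nat.le_add_left _ _)⟩
  set w := u ++ (List.replicate N (W i)).flatten ++ (W i).take l with hw
  have hnear : ‖wordProd A w *ᵥ y - (f i ⬝ᵥ z) • y‖ < κ * ‖y‖ := by
    have h1 : wordProd A w *ᵥ y - (f i ⬝ᵥ z) • y =
        wordProd A ((W i).take l) *ᵥ (wordProd A (W i) ^ N *ᵥ z - (f i ⬝ᵥ z) • v i) := by
      rw [hw, wordProd_append_mulVec, wordProd_append_mulVec, wordProd_flatten_replicate,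
        Matrix.mulVec_sub, Matrix.mulVec_smul]
    rw [h1]
    calc _ ≤ C * (κ / (2 * C ^ 2) * (C * ‖y‖)) := by
          refine (hbd _ _).trans (mul_le_mul_of_nonneg_left ?_ hC.le)
          refine (hN₁ N hNN z).trans (mul_le_mul_of_nonneg_left (hbd _ _) (by positivity))
      _ = κ / 2 * ‖y‖ := by field_simp
      _ < κ * ‖y‖ := by nlinarith
  have hρw : ¬ specRad (wordProd A w) ≤ γ := fun h =>
    absurd (happ _ _ (hbd w) h hlarge.le le_rfl y) (not_le.2 hnear)
  have hw0 : w ≠ [] := by simp [hw, hu]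
  by_cases hex : ∃ i, ∃ u, u.IsRotated (W i) ∧ IsPowerOf w u
  · obtain ⟨j, u', hrot, hpow⟩ := hex
    refine hleave ((getElem?_zero_eq_of_isPowerOf hW hdiff hu hlt (hN j) hrot hpow).trans ?_)
    exact cyc_eq_of_modEq (Nat.mod_modEq _ _)
  · exact hρw (hdom w hw0 hex).le

/-- The components of all orbits leaving their cycles are uniformly smaller than the balancing
coefficients: for different roots by admissibility, for the same root by dominance. -/
lemma exists_uniform_gap [NeZero d] (hW : ∀ i, SimpleWord (W i))
    (hdiff : ∀ i j, i ≠ j → ¬ (W i).IsRotated (W j))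
    (hfix : ∀ i, wordProd A (W i) *ᵥ v i = v i) (hv : ∀ i, v i ≠ 0) (hα : ∀ i, 0 < α i)
    (hρ : ∀ i, specRad (wordProd A (W i)) = 1)
    (hs : ∀ i, UniqueSimpleLeadingEigenvalue (wordProd A (W i)))
    {f : Fin r → Fin d → ℝ} (hf : ∀ j, (wordProd A (W j))ᵀ *ᵥ f j = f j ∧ f j ⬝ᵥ v j = 1)
    (hadm : ∀ i j, i ≠ j →
      ENNReal.ofReal (α i) * q A (W i) (v i) (f j) < ENNReal.ofReal (α j))
    {γ : ℝ} (hγ : γ < 1) (hdom : ∀ w : List (Fin m), w ≠ [] →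
      (¬ ∃ i, ∃ u, u.IsRotated (W i) ∧ IsPowerOf w u) → specRad (wordProd A w) < γ)
    {C : ℝ} (hC : 0 < C) (hbd : ∀ w x, ‖wordProd A w *ᵥ x‖ ≤ C * ‖x‖) :
    ∃ δ : ℝ, 0 < δ ∧ δ < 1 ∧ ∀ i t u, u ≠ [] → u[0]? ≠ cyc (W i) t → ∀ j,
      |f j ⬝ᵥ (wordProd A u *ᵥ rootPt A W v α i t)| ≤ (1 - δ) * α j := by
  have hone : ∀ i j, ∃ δ : ℝ, 0 < δ ∧ ∀ t u, u ≠ [] → u[0]? ≠ cyc (W i) t →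
      |f j ⬝ᵥ (wordProd A u *ᵥ rootPt A W v α i t)| ≤ (1 - δ) * α j := by
    intro i j
    by_cases hij : i = j
    · subst hij
      refine ⟨1 - (1 + γ) / 2, by linarith, fun t u hu hleave => ?_⟩
      rw [sub_sub_cancel]
      exact abs_dotProduct_orbit_le_of_leaves hW hdiff hfix hv hα hρ hs hf hγ hdom hC hbd i t u hu
        hleave
    · have h1 := hadm i j hij
      set a := (ENNReal.ofReal (α i) * q A (W i) (v i) (f j)).toReal with ha
      have hne : ENNReal.ofReal (α i) * q A (W i) (v i) (f j) ≠ ⊤ := h1.ne_top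
      have haα : a < α j := (ENNReal.lt_ofReal_iff_toReal_lt hne).1 h1
      refine ⟨1 - a / α j, by rw [sub_pos, div_lt_one (hα j)]; exact haα, fun t u _ _ => ?_⟩
      rw [sub_sub_cancel, div_mul_cancel₀ _ (hα j).ne']
      have hlt : t % (W i).length < (W i).length := Nat.mod_lt _ (hW i).length_pos
      have h2 : ENNReal.ofReal |f j ⬝ᵥ (wordProd A u *ᵥ
          rootVec A (W i) (v i) ⟨t % (W i).length, hlt⟩)| ≤ q A (W i) (v i) (f j) :=
        le_iSup₂ (f := fun (l : Fin (W i).length) (u : List (Fin m)) =>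
          ENNReal.ofReal |f j ⬝ᵥ (wordProd A u *ᵥ rootVec A (W i) (v i) l)|) _ u
      have h3 := mul_le_mul_right h2 (ENNReal.ofReal (α i))
      rw [← ENNReal.ofReal_mul (hα i).le] at h3
      have h4 := ENNReal.toReal_mono hne h3
      rw [ENNReal.toReal_ofReal (mul_nonneg (hα i).le (abs_nonneg _))] at h4
      refine le_trans (le_of_eq ?_) h4
      rw [← rootPt_mod, rootPt_eq_smul_rootVec (l := ⟨t % (W i).length, hlt⟩),
        Matrix.mulVec_smul, dotProduct_smul, smul_eq_mul, abs_mul, abs_of_pos (hα i)]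
  choose δ hδ hδ' using hone
  have hev : ∀ᶠ e : ℝ in 𝓝[>] 0, e ∈ Set.Ioo (0 : ℝ) 1 ∧ ∀ p : Fin r × Fin r, e < δ p.1 p.2 :=
    Filter.Eventually.and (Ioo_mem_nhdsGT one_pos)
      (eventually_all.2 fun p => nhdsWithin_le_nhds (eventually_lt_nhds (hδ p.1 p.2)))
  obtain ⟨e, he, hall⟩ := hev.exists
  refine ⟨e, he.1, he.2, fun i t u hu hleave j => (hδ' i j t u hu hleave).trans ?_⟩
  have := hall (i, j)
  simp only at this
  exact mul_le_mul_of_nonneg_right (by linarith) (hα j).le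

lemma smul_mem_absco {V : Set (Fin d → ℝ)} {x : Fin d → ℝ} (hx : x ∈ absco V) {s : ℝ}
    (hs : |s| ≤ 1) : s • x ∈ absco V := by
  obtain ⟨h1, h2⟩ := abs_le.1 hs
  have := (convex_absco V) hx (neg_mem_absco hx) (a := (1 + s) / 2) (b := (1 - s) / 2)
    (by linarith) (by linarith) (by ring)
  convert this using 1
  module

/-- Among sufficiently many vectors of a bounded set there are two close ones. -/
lemma exists_close_pair (Z : ℝ) {κ : ℝ} (hκ : 0 < κ) :
    ∃ Q : ℕ, ∀ y : ℕ → Fin d → ℝ, (∀ p, ‖y p‖ ≤ Z) →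
      ∃ p p', p < p' ∧ p' ≤ Q ∧ ‖y p' - y p‖ < κ := by
  classical
  obtain ⟨T, -, hT, hcov⟩ := (isCompact_closedBall (0 : Fin d → ℝ) Z).finite_cover_balls
    (half_pos hκ)
  refine ⟨hT.toFinset.card, fun y hy => ?_⟩
  have hc : ∀ p, ∃ x ∈ T, dist (y p) x < κ / 2 := by
    intro p
    have := hcov (show y p ∈ Metric.closedBall 0 Z by simpa using hy p)
    simpa using this
  choose g hgT hg using hc
  obtain ⟨p, hp, p', hp', hne, he⟩ := Finset.exists_ne_map_eq_of_card_lt_of_maps_to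
    (s := Finset.range (hT.toFinset.card + 1)) (t := hT.toFinset) (f := g) (by simp)
    (fun p _ => by simpa using hgT p)
  have hclose : ∀ a b, g a = g b → ‖y b - y a‖ < κ := by
    intro a b hab
    rw [← dist_eq_norm]
    have := dist_triangle_right (y b) (y a) (g b)
    have h1 := hg a
    have h2 := hg b
    rw [hab] at h1
    linarith
  rw [Finset.mem_range] at hp hp'
  rcases lt_or_gt_of_ne hne with h | h
  · exact ⟨p, p', h, by omega, hclose _ _ he⟩
  · exact ⟨p', p, h, by omega, hclose _ _ he.symm⟩

/-- Turning many times around a cycle brings every orbit that has left its own cycle into the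
interior of the current polytope. -/
lemma exists_pow_mulVec_mem_interior [NeZero d]
    (hfix : ∀ i, wordProd A (W i) *ᵥ v i = v i) (hα : ∀ i, 0 < α i)
    (hρ : ∀ i, specRad (wordProd A (W i)) = 1)
    (hs : ∀ i, UniqueSimpleLeadingEigenvalue (wordProd A (W i)))
    {f : Fin r → Fin d → ℝ} (hf : ∀ j, (wordProd A (W j))ᵀ *ᵥ f j = f j ∧ f j ⬝ᵥ v j = 1)
    {δ : ℝ} (hδ0 : 0 < δ) (hδ1 : δ < 1) {X : Set (Fin d → ℝ)} {Z : ℝ} (hZ0 : 0 ≤ Z)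
    (hXZ : ∀ z ∈ X, ‖z‖ ≤ Z) (hX : ∀ z ∈ X, ∀ j, |f j ⬝ᵥ z| ≤ (1 - δ) * α j)
    {V : Set (Fin d → ℝ)} (hV : ∀ i, α i • v i ∈ V) {ε : ℝ} (hε : 0 < ε)
    (hball : Metric.ball 0 ε ⊆ absco V) :
    ∃ N : ℕ, ∀ z ∈ X, ∀ j, wordProd A (W j) ^ N *ᵥ z ∈ interior (absco V) := by
  have hη : 0 < δ * ε / (Z + 1) := by positivity
  choose N hN using fun j =>
    exists_pow_mulVec_sub_le (hs j) (hρ j) (hfix j) (hf j).1 (hf j).2 hη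
  refine ⟨∑ j, N j, fun z hz j => ?_⟩
  have h1 := hN j (∑ j, N j) (Finset.single_le_sum (fun _ _ => Nat.zero_le _)
    (Finset.mem_univ j)) z
  set e := wordProd A (W j) ^ (∑ j, N j) *ᵥ z - (f j ⬝ᵥ z) • v j with he
  have he1 : ‖e‖ < δ * ε := by
    refine h1.trans_lt ?_
    rw [div_mul_eq_mul_div, div_lt_iff₀ (by positivity)]
    have := mul_le_mul_of_nonneg_left (hXZ z hz) (mul_pos hδ0 hε).le
    nlinarith [mul_pos hδ0 hε]
  have hb : δ⁻¹ • e ∈ interior (absco V) := by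
    refine interior_maximal hball Metric.isOpen_ball ?_
    rw [mem_ball_zero_iff, norm_smul, Real.norm_eq_abs, abs_of_pos (inv_pos.2 hδ0),
      inv_mul_lt_iff₀ hδ0]
    exact he1
  have h1δ : 0 < 1 - δ := sub_pos.2 hδ1
  have hp : ((f j ⬝ᵥ z) / ((1 - δ) * α j)) • (α j • v j) ∈ absco V := by
    refine smul_mem_absco (subset_absco V (hV j)) ?_
    rw [abs_div, abs_of_pos (mul_pos h1δ (hα j)), div_le_one (mul_pos h1δ (hα j))]
    exact hX z hz j
  have := (convex_absco V).combo_self_interior_mem_interior hp hb h1δ.le hδ0 (by ring)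
  convert this using 1
  rw [smul_smul, smul_smul, smul_smul, mul_inv_cancel₀ hδ0.ne', one_smul, he]
  have hc : (1 - δ) * (f j ⬝ᵥ z / ((1 - δ) * α j)) * α j = f j ⬝ᵥ z := by
    have := (hα j).ne'
    field_simp
  rw [hc]
  abel

/-- A long path of points that are never absorbed returns close to itself. The word of the return
has spectral radius close to one, so it turns around a cycle many times, and the path is absorbed
after all. -/
lemma terminates_of_dominant [NeZero d] (hA : IrreducibleFamily A) (hr : 1 ≤ r)
    (hW : ∀ i, SimpleWord (W i)) (hdiff : ∀ i j, i ≠ j → ¬ (W i).IsRotated (W j))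
    (hfix : ∀ i, wordProd A (W i) *ᵥ v i = v i) (hv : ∀ i, v i ≠ 0) (hα : ∀ i, 0 < α i)
    (horder : ∀ k S x, x ∈ order k S ↔ x ∈ S)
    (hρ : ∀ i, specRad (wordProd A (W i)) = 1)
    (hs : ∀ i, UniqueSimpleLeadingEigenvalue (wordProd A (W i)))
    (hadm : Admissible A W v α)
    {γ : ℝ} (hγ : γ < 1) (hdom : ∀ w : List (Fin m), w ≠ [] →
      (¬ ∃ i, ∃ u, u.IsRotated (W i) ∧ IsPowerOf w u) → specRad (wordProd A w) < γ) :
    Terminates A W v α order := by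
  obtain ⟨f, hf, hadm⟩ := hadm
  obtain ⟨C, hC, hbd⟩ := exists_bound_of_dominant hA hfix hρ hs hf hγ hdom
  obtain ⟨δ, hδ0, hδ1, hgap⟩ :=
    exists_uniform_gap hW hdiff hfix hv hα hρ hs hf hadm hγ hdom hC hbd
  obtain ⟨K, hK⟩ := exists_span_state_eq_top hA hr hW hfix hv hα horder
  obtain ⟨ε, hε, hball⟩ := Metric.mem_nhds_iff.1
    (mem_interior_iff_mem_nhds.1 (zero_mem_interior_absco hK))
  set P := absco ((state A W v α order K).1 : Set (Fin d → ℝ)) with hP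
  have hballi : Metric.ball 0 ε ⊆ interior P := interior_maximal hball Metric.isOpen_ball
  set Z := ∑ i, C * (α i * (C * ‖v i‖)) with hZ
  have hZ0 : 0 ≤ Z := Finset.sum_nonneg fun i _ => by have := hα i; positivity
  have hZb : ∀ u i t, ‖wordProd A u *ᵥ rootPt A W v α i t‖ ≤ Z := by
    intro u i t
    have h1 : ‖wordProd A u *ᵥ rootPt A W v α i t‖ ≤ C * (α i * (C * ‖v i‖)) := by
      refine (hbd _ _).trans (mul_le_mul_of_nonneg_left ?_ hC.le)
      rw [rootPt, norm_smul, Real.norm_eq_abs, abs_of_pos (hα i)]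
      exact mul_le_mul_of_nonneg_left (hbd _ _) (hα i).le
    exact h1.trans (Finset.single_le_sum (f := fun i => C * (α i * (C * ‖v i‖)))
      (fun i _ => by have := hα i; positivity) (Finset.mem_univ i))
  obtain ⟨N, hN⟩ := exists_pow_mulVec_mem_interior hfix hα hρ hs hf hδ0 hδ1
    (X := {z | ∃ i t u, u ≠ [] ∧ u[0]? ≠ cyc (W i) t ∧ z = wordProd A u *ᵥ rootPt A W v α i t})
    hZ0 (by rintro _ ⟨i, t, u, -, -, rfl⟩; exact hZb u i t)
    (by rintro _ ⟨i, t, u, hu, hl, rfl⟩; exact hgap i t u hu hl)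
    (fun i => by
      have := rootPt_mem_state (A := A) (v := v) (α := α) (order := order) hW K i 0
      rwa [rootPt_zero] at this) hε hball
  obtain ⟨κ, hκ, happ⟩ := exists_approx_eigen_bound (d := d) C 1 γ 1 hγ
  obtain ⟨Q, hQ⟩ := exists_close_pair (d := d) Z (mul_pos hκ hε)
  -- the length of the steps in which returns are sought
  set T := (N + 1) * ∑ i, (W i).length with hT
  have hTi : ∀ i, (N + 1) * (W i).length ≤ T := fun i => Nat.mul_le_mul_left _
    (Finset.single_le_sum (f := fun i => (W i).length) (fun _ _ => Nat.zero_le _)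
      (Finset.mem_univ i))
  have hT0 : 0 < T := lt_of_lt_of_le (Nat.mul_pos (Nat.succ_pos _) (hW ⟨0, hr⟩).length_pos)
    (hTi ⟨0, hr⟩)
  by_contra hnot
  have hne : (state A W v α order (K + Q * T + 1)).2.Nonempty := by
    rw [Finset.nonempty_iff_ne_empty]
    exact fun h => hnot ⟨_, by omega, h⟩
  obtain ⟨x, hx⟩ := hne
  obtain ⟨i, t, u, hulen, hu0, -, hpath⟩ := exists_path_of_mem_state_snd hW horder hx
  have hout : ∀ τ, K + 1 ≤ τ → τ ≤ K + Q * T + 1 →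
      wordProd A (u.take τ) *ᵥ rootPt A W v α i t ∉ interior P := by
    intro τ h1 h2 hin
    obtain ⟨p, rfl⟩ : ∃ p, τ = p + 1 := ⟨τ - 1, by omega⟩
    exact hpath p (by omega) (interior_absco_state_mono (by omega) hin)
  obtain ⟨p, p', hpp, hpQ, hclose⟩ := hQ
    (fun p => wordProd A (u.take (K + 1 + p * T)) *ᵥ rootPt A W v α i t) fun p => hZb _ i t
  obtain ⟨n, rfl⟩ : ∃ n, p' = p + (n + 1) := ⟨p' - p - 1, by omega⟩
  have hend : K + 1 + p * T + (n + 1) * T ≤ K + Q * T + 1 := by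
    have := Nat.mul_le_mul_right T hpQ
    rw [add_mul] at this
    omega
  have hTn : T ≤ (n + 1) * T := Nat.le_mul_of_pos_left T (Nat.succ_pos n)
  set s := K + 1 + p * T with hs'
  set w := (u.drop s).take ((n + 1) * T) with hw
  have hwlen : w.length = (n + 1) * T := by
    rw [hw, List.length_take, List.length_drop, hulen]; omega
  have hw0 : w ≠ [] := by rw [← List.length_pos_iff, hwlen]; omega
  set y := wordProd A (u.take s) *ᵥ rootPt A W v α i t with hy
  have hyw : wordProd A (u.take (K + 1 + (p + (n + 1)) * T)) *ᵥ rootPt A W v α i t =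
      wordProd A w *ᵥ y := by
    rw [hy, ← wordProd_append_mulVec, hw, ← List.take_add, hs']
    congr 3
    ring
  have hyε : ε ≤ ‖y‖ := by
    by_contra! hlt
    exact hout s (by omega) (by omega) (hballi (mem_ball_zero_iff.2 hlt))
  have hnotρ : ¬ specRad (wordProd A w) ≤ γ := by
    intro h
    have h1 := happ _ 1 (hbd w) h (by simp) (by simp) y
    simp only [hyw] at hclose
    rw [one_smul] at h1
    have h2 := mul_le_mul_of_nonneg_left hyε hκ.le
    linarith
  by_cases hex : ∃ i, ∃ u, u.IsRotated (W i) ∧ IsPowerOf w u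
  swap
  · exact hnotρ (hdom w hw0 hex).le
  obtain ⟨j, u', hrot, hpow⟩ := hex
  obtain ⟨-, o, ho⟩ := exists_agree_of_isPowerOf_rotated hrot hpow
  have hn := (hW j).length_pos
  -- the first position of `w` at which a copy of `W j` starts
  obtain ⟨a, ha, hao⟩ : ∃ a, a < (W j).length ∧ o + a ≡ 0 [MOD (W j).length] := by
    refine ⟨((W j).length - o % (W j).length) % (W j).length, Nat.mod_lt _ hn, ?_⟩
    have h1 := (Nat.mod_lt o hn).le
    calc o + ((W j).length - o % (W j).length) % (W j).length
        ≡ o % (W j).length + ((W j).length - o % (W j).length) [MOD (W j).length] :=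
          (Nat.mod_modEq _ _).symm.add (Nat.mod_modEq _ _)
      _ = (W j).length := by omega
      _ ≡ 0 [MOD (W j).length] := by simp [Nat.ModEq]
  have hTj := hTi j
  rw [add_mul, one_mul] at hTj
  have hfac : (u.drop (s + a)).take (N * (W j).length) = (List.replicate N (W j)).flatten := by
    apply List.ext_getElem?
    intro q
    by_cases hq : q < N * (W j).length
    · have h1 := ho (a + q) (by omega)
      rw [hw, List.getElem?_take_of_lt (by omega), List.getElem?_drop] at h1
      rw [getElem?_flatten_replicate _ _ hq, List.getElem?_take_of_lt hq, List.getElem?_drop,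
        add_assoc, h1]
      apply cyc_eq_of_modEq
      have := hao.add_right q
      rwa [zero_add, add_assoc] at this
    · rw [List.getElem?_eq_none (by rw [List.length_take]; omega),
        List.getElem?_eq_none (by simp; omega)]
  have hin : wordProd A (u.take (s + a + N * (W j).length)) *ᵥ rootPt A W v α i t ∈
      interior P := by
    rw [List.take_add, wordProd_append_mulVec, hfac, wordProd_flatten_replicate]
    refine hN _ ⟨i, t, u.take (s + a), ?_, ?_, rfl⟩ j
    · rw [← List.length_pos_iff, List.length_take]; omega
    · rwa [List.getElem?_take_of_lt (by omega)]
  exact hout _ (by omega) (by omega) hin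

end Backward

/-! ### Normalization -/

section Normalization

variable {d m : ℕ} {A : Fin m → Matrix (Fin d) (Fin d) ℝ}

lemma IrreducibleFamily.normalizedFamily (hA : IrreducibleFamily A) {c : ℝ} (hc : c ≠ 0) :
    IrreducibleFamily (normalizedFamily A c) := by
  intro U hU
  refine hA U fun s x hx => ?_
  have := U.smul_mem c (hU s x hx)
  rwa [InvariantPolytope.normalizedFamily, Matrix.smul_mulVec, smul_smul, mul_inv_cancel₀ hc,
    one_smul] at this

end Normalization

end InvariantPolytope

open InvariantPolytope
theorem theorem1 {d m r : ℕ} (hr : 1 ≤ r)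
    (A : Fin m → Matrix (Fin d) (Fin d) ℝ) (hA : IrreducibleFamily A)
    (W : Fin r → List (Fin m)) (hsimple : ∀ i, SimpleWord (W i))
    (hdiff : ∀ i j, i ≠ j → ¬ (W i).IsRotated (W j))
    (ρc : ℝ) (hρ : ∀ i, specRad (wordProd A (W i)) ^ (1 / ((W i).length : ℝ)) = ρc)
    (v : Fin r → Fin d → ℝ) (hv : ∀ i, v i ≠ 0)
    (hlead : ∀ i, wordProd (normalizedFamily A ρc) (W i) *ᵥ v i = v i)
    (α : Fin r → ℝ) (hα : ∀ i, 0 < α i)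
    (order : ℕ → Finset (Fin d → ℝ) → List (Fin d → ℝ))
    (horder : ∀ k S x, x ∈ order k S ↔ x ∈ S) :
    Terminates (normalizedFamily A ρc) W v α order ↔
      Dominant A W ∧
      (∀ i, UniqueSimpleLeadingEigenvalue (wordProd A (W i))) ∧
      Admissible (normalizedFamily A ρc) W v α := by
  have : NeZero d := ⟨by rintro rfl; exact hv ⟨0, hr⟩ (Subsingleton.elim _ _)⟩
  have hn : ∀ i, (W i).length ≠ 0 := fun i => (hsimple i).length_pos.ne'
  -- if `ρc` were zero, the normalized products, formed with `0⁻¹ = 0`, would not fix the `v i`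
  have hρ0 : ρc ≠ 0 := by
    rintro rfl
    apply hv ⟨0, hr⟩
    rw [← hlead ⟨0, hr⟩, wordProd_normalizedFamily, inv_zero, zero_pow (hn _), zero_smul,
      Matrix.zero_mulVec]
  have hρpos : 0 < ρc := by
    refine lt_of_le_of_ne ?_ hρ0.symm
    rw [← hρ ⟨0, hr⟩]
    exact Real.rpow_nonneg (specRad_nonneg _) _
  have hcpos : ∀ i, 0 < ρc⁻¹ ^ (W i).length := fun i => by positivity
  have hρ1 : ∀ i, specRad (wordProd (normalizedFamily A ρc) (W i)) = 1 := by
    intro i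
    have h1 : ρc ^ (W i).length = specRad (wordProd A (W i)) := by
      rw [← hρ i, one_div, Real.rpow_inv_natCast_pow (specRad_nonneg _) (hn i)]
    rw [wordProd_normalizedFamily, specRad_smul _ (hcpos i), ← h1, ← mul_pow,
      inv_mul_cancel₀ hρ0, one_pow]
  have huniq : ∀ i, UniqueSimpleLeadingEigenvalue (wordProd (normalizedFamily A ρc) (W i)) ↔
      UniqueSimpleLeadingEigenvalue (wordProd A (W i)) := fun i => by
    rw [wordProd_normalizedFamily]
    exact uniqueSimpleLeadingEigenvalue_smul_iff (hcpos i)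
  have hA' := hA.normalizedFamily hρ0
  constructor
  · intro hterm
    obtain ⟨V, l, N, h⟩ := exists_isContractingPolytope hA' hr hsimple hlead hv hα horder hterm
    exact ⟨⟨ρc, hρ, h.exists_specRad_lt hsimple⟩,
      fun i => (huniq i).1
        (h.uniqueSimpleLeadingEigenvalue hsimple hdiff hlead hv i (hρ1 i)),
      h.admissible hsimple hdiff hlead hv hα⟩
  · rintro ⟨⟨c, hc, γ, hγ, hdom⟩, hs, hadm⟩
    obtain rfl : c = ρc := (hc ⟨0, hr⟩).symm.trans (hρ ⟨0, hr⟩)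
    exact terminates_of_dominant hA' hr hsimple hdiff hlead hv hα horder hρ1
      (fun i => (huniq i).2 (hs i)) hadm hγ hdom
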